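/- Fix real constants $\gamma_0>0$, $\lambda>0$, $\eta\in(0,1)$, $s\ge 0$, $C>0$, $C_X>0$, $B\ge 0$ and a function $C_Y:\mathbb{R}\to\mathbb{R}$. Let $n,p$ be integers with $n/p=\gamma_0$, and consider the following setting. (A1) $\Theta\subseteq\mathbb{R}^p$ is closed and convex, and contains a point $\beta_0$ with $\|\beta_0\|^2\le Bp$ and $r_0(\beta_0)\le Bp$, where $r_0$ is as in (A4). (For $B=0$ this says $0\in\Theta$ and $r_0(0)=0$.) (A3) $(x_0,y_0),(x_1,y_1),\dots,(x_n,y_n)\in\mathbb{R}^p\times\mathbb{R}$ are i.i.d., with $x_i\sim N(0,\Sigma)$, where all eigenvalues of $\Sigma$ lie in $[c_X/p,\,C_X/p]$ for some $0<c_X\le C_X$. The conditional law of $y_i$ given $x_i$ is arbitrary. (A4) $r(\beta)=(1-\eta)\,r_0(\beta)+\eta\,\beta^\top\beta$, where $r_0:\mathbb{R}^p\to\mathbb{R}$ is non-negative, convex and Lipschitz continuous. (A5) $\ell,\phi:\mathbb{R}\times\mathbb{R}\to[0,\infty)$ are measurable, and $\ell(y,z)$ and $\phi(y,z)$ are convex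 and continuously differentiable in $z$. With $\dot\ell=\partial_z\ell$ and $\dot\phi=\partial_z\phi$, $$\max\{|\ell(y,z)|,|\dot\ell(y,z)|,|\phi(y,z)|,|\dot\phi(y,z)|\}\le C(1+|y|^s+|z|^s)\quad\text{for all } y,z .$$ Moreover $\mathbb{E}|y_i|^m\le C_Y(m)<\infty$ for all real $m>0$. Let $$\hat\beta=\operatorname*{argmin}_{\beta\in\Theta}\sum_{j=1}^n\ell(y_j,x_j^\top\beta)+\lambda r(\beta),\qquad \hat\beta_{/i}=\operatorname*{argmin}_{\beta\in\Theta}\sum_{j\ne i}\ell(y_j,x_j^\top\beta)+\lambda r(\beta),$$ where the sums run over $1\le j\le n$, and let $$\mathrm{LO}=\frac1n\sum_{i=1}^n\phi(y_i,x_i^\top\hat\beta_{/i}),\qquad \mathrm{OO}=\mathbb{E}\big[\phi(y_0,x_0^\top\hat\beta)\,\big|\,(x_1,y_1),\dots,(x_n,y_n)\big].$$ Then there is a constant $C_v$ depending only on $\gamma_0,\lambda,\eta,s,C,C_X,B$ and $C_Y(\cdot)$ such that in every such setting $(\mathrm{LO}-\mathrm{OO})^2$ is integrable and $$\mathbb{E}(\mathrm{LO}-\mathrm{OO})^2\le\frac{C_v}{n}.$$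 In particular, LO is consistent: along every sequence of such settings, with the same constants and with $n\to\infty$, $\mathrm{LO}-\mathrm{OO}\to0$ in probability. -/

import Mathlib

open MeasureTheory ProbabilityTheory Filter Topology

namespace LeaveOneOut

/-- A feature vector together with its response. -/
abbrev Obs (p : ℕ) : Type := EuclideanSpace ℝ (Fin p) × ℝ

/-- The deterministic ingredients of a regularized estimation problem in dimension `p`:
constraint set, base regularizer, loss, risk function and feature covariance. -/
structure Problem (p : ℕ) where
  /-- the constraint set -/
  Θ : Set (EuclideanSpace ℝ (Fin p))
  /-- the (possibly non-smooth) part of the regularizer -/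
  r₀ : EuclideanSpace ℝ (Fin p) → ℝ
  /-- the loss `ℓ y z` -/
  loss : ℝ → ℝ → ℝ
  /-- the risk function `φ y z` -/
  risk : ℝ → ℝ → ℝ
  /-- the covariance matrix of the features -/
  cov : Matrix (Fin p) (Fin p) ℝ

variable {n p : ℕ} {Ω : Type*}

/-- The regularizer `r(β) = (1 - η) r₀(β) + η βᵀβ`. -/
noncomputable def Problem.regularizer (P : Problem p) (η : ℝ)
    (β : EuclideanSpace ℝ (Fin p)) : ℝ :=
  (1 - η) * P.r₀ β + η * ‖β‖ ^ 2

/-- The penalized empirical risk over the observations of `D` with index in `J`. -/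
noncomputable def Problem.objective (P : Problem p) (lam η : ℝ) (J : Finset (Fin n))
    (D : Fin n → Obs p) (β : EuclideanSpace ℝ (Fin p)) : ℝ :=
  ∑ j ∈ J, P.loss (D j).2 (inner ℝ (D j).1 β) + lam * P.regularizer η β

/-- The regularized empirical risk minimizer over `Θ` based on the observations with index in `J`.
(For nonempty closed convex `Θ` and a convex loss the minimizer exists and is unique,
by strong convexity of the objective.) -/
noncomputable def Problem.estimate (P : Problem p) (lam η : ℝ) (J : Finset (Fin n))
    (D : Fin n → Obs p) : EuclideanSpace ℝ (Fin p) :=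
  Classical.epsilon fun β => β ∈ P.Θ ∧ IsMinOn (P.objective lam η J D) P.Θ β

/-- The training set: observations `1, …, n` of the sample; observation `0` is kept as the
fresh test point. -/
def train (Z : Fin (n + 1) → Ω → Obs p) (ω : Ω) : Fin n → Obs p :=
  fun i => Z i.succ ω

/-- The leave-one-out estimate `(1/n) ∑ i, φ(y i, x iᵀ β_{/i})`. -/
noncomputable def Problem.LO (P : Problem p) (lam η : ℝ) (Z : Fin (n + 1) → Ω → Obs p)
    (ω : Ω) : ℝ :=
  (1 / (n : ℝ)) * ∑ i : Fin n,
    P.risk (train Z ω i).2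
      (inner ℝ (train Z ω i).1 (P.estimate lam η (Finset.univ.erase i) (train Z ω)))

/-- The out-of-sample risk: the conditional expectation of `φ(y₀, x₀ᵀ β)` given the training
set, where `β` is the estimate based on the whole training set. -/
noncomputable def Problem.OO [MeasurableSpace Ω] (P : Problem p) (lam η : ℝ) (μ : Measure Ω)
    (Z : Fin (n + 1) → Ω → Obs p) : Ω → ℝ :=
  μ[fun ω => P.risk (Z 0 ω).2
      (inner ℝ (Z 0 ω).1 (P.estimate lam η Finset.univ (train Z ω)))
    | MeasurableSpace.comap (train Z) inferInstance]

/-- `ℓ(y, z)` is nonnegative, measurable, convex and continuously differentiable in `z`, and it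
and its `z`-derivative are bounded by `C (1 + |y|^s + |z|^s)`. -/
structure AdmissibleLoss (s C : ℝ) (f : ℝ → ℝ → ℝ) : Prop where
  measurable : Measurable (Function.uncurry f)
  nonneg : ∀ y z, 0 ≤ f y z
  convex : ∀ y, ConvexOn ℝ Set.univ (f y)
  contDiff : ∀ y, ContDiff ℝ 1 (f y)
  growth : ∀ y z, |f y z| ≤ C * (1 + |y| ^ s + |z| ^ s)
  growth_deriv : ∀ y z, |deriv (f y) z| ≤ C * (1 + |y| ^ s + |z| ^ s)

/-- The deterministic assumptions. The constraint set contains a point `β₀` with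
`‖β₀‖² ≤ B p` and `r₀ β₀ ≤ B p` (for `B = 0`: the origin, with `r₀ 0 = 0`). -/
structure Problem.Admissible (P : Problem p) (s C C_X B : ℝ) : Prop where
  isClosed : IsClosed P.Θ
  convex : Convex ℝ P.Θ
  anchor : ∃ β₀ ∈ P.Θ, ‖β₀‖ ^ 2 ≤ B * p ∧ P.r₀ β₀ ≤ B * p
  reg_nonneg : ∀ β, 0 ≤ P.r₀ β
  reg_convex : ConvexOn ℝ Set.univ P.r₀
  reg_lipschitz : ∃ K : NNReal, LipschitzWith K P.r₀
  loss : AdmissibleLoss s C P.loss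
  risk : AdmissibleLoss s C P.risk
  cov_posSemidef : P.cov.PosSemidef
  cov_eigenvalues : ∃ c_X : ℝ, 0 < c_X ∧ c_X ≤ C_X ∧
    ∀ i, c_X / p ≤ cov_posSemidef.isHermitian.eigenvalues i ∧
      cov_posSemidef.isHermitian.eigenvalues i ≤ C_X / p

/-- The sample `Z 0, …, Z n` is i.i.d. with centred Gaussian features of covariance `P.cov`,
and the absolute moment of order `m` of the responses is at most `C_Y m`, for all `m > 0`. The
conditional law of the response given the features is arbitrary. -/
structure Problem.IsSample [MeasurableSpace Ω] (P : Problem p) (C_Y : ℝ → ℝ) (μ : Measure Ω)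
    (Z : Fin (n + 1) → Ω → Obs p) : Prop where
  measurable : ∀ i, Measurable (Z i)
  indep : iIndepFun Z μ
  identDistrib : ∀ i, IdentDistrib (Z i) (Z 0) μ μ
  features : ∀ i, HasLaw (fun ω => (Z i ω).1) (multivariateGaussian 0 P.cov) μ
  moments : ∀ i, ∀ m : ℝ, 0 < m →
    Integrable (fun ω => |(Z i ω).2| ^ m) μ ∧ ∫ ω, |(Z i ω).2| ^ m ∂μ ≤ C_Y m

end LeaveOneOut

/-!
Removing one observation moves the regularized estimate by `O(1)` in Euclidean norm, because the
objective is strongly convex and the loss of the removed observation has a gradient of that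
size. A fresh feature vector does not depend on this displacement, so the inner product of the two,
and with it the change of the risk at a fresh point, is only of order `p ^ (-1/2)` in `L²`.

The difference `LO - OO` is the average of `F i - 𝔼ᵢ (F i)`, where `F i` is the risk at observation
`i` of the estimate without `i` and `𝔼ᵢ` averages over observation `i` alone, plus an average of
differences of expected risks, each of order `p ^ (-1/2)`. The summands of the first average are
nearly orthogonal: functions that do not depend on observation `j` are orthogonal to the fluctuation
in observation `j`, so in the product of the summands `i` and `j` one may subtract from `F i` its
version without observation `j` and vice versa, and both differences are of order `p ^ (-1/2)`.
Hence every off-diagonal term is `O(1 / p)`, and the `n` diagonal terms contribute `O(1 / n)`.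
-/

namespace LeaveOneOut

open scoped ENNReal NNReal

section Minimization

theorem sub_le_deriv_mul_sub {f : ℝ → ℝ} (hf : ConvexOn ℝ Set.univ f) {a : ℝ}
    (hd : DifferentiableAt ℝ f a) (b : ℝ) : f a - f b ≤ deriv f a * (a - b) := by
  rcases lt_trichotomy a b with h | rfl | h
  · have hslope := hf.deriv_le_slope (Set.mem_univ a) (Set.mem_univ b) h hd
    rw [slope_def_field, le_div_iff₀ (sub_pos.2 h)] at hslope
    linarith
  · simp
  · have hslope := hf.slope_le_deriv (Set.mem_univ b) (Set.mem_univ a) h hd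
    rw [slope_def_field, div_le_iff₀ (sub_pos.2 h)] at hslope
    linarith

theorem add_sq_norm_sub_le_of_isMinOn {E : Type*} [NormedAddCommGroup E] [NormedSpace ℝ E]
    {S : Set E} {m : ℝ} {f : E → ℝ} (hf : StrongConvexOn S m f) {a b : E} (ha : a ∈ S)
    (hb : b ∈ S) (hmin : IsMinOn f S a) : f a + m / 2 * ‖b - a‖ ^ 2 ≤ f b := by
  have hsegment : ∀ t ∈ Set.Ioo (0 : ℝ) 1, (1 - t) * (m / 2 * ‖b - a‖ ^ 2) ≤ f b - f a := by
    intro t ht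
    have hconv := hf.2 hb ha ht.1.le (sub_nonneg.2 ht.2.le) (add_sub_cancel t 1)
    have hle : f a ≤ f (t • b + (1 - t) • a) :=
      hmin (hf.1 hb ha ht.1.le (sub_nonneg.2 ht.2.le) (add_sub_cancel t 1))
    simp only [smul_eq_mul] at hconv
    exact le_of_mul_le_mul_left (by linarith) ht.1
  have hlim : Tendsto (fun t : ℝ => (1 - t) * (m / 2 * ‖b - a‖ ^ 2)) (𝓝[>] 0)
      (𝓝 ((1 - 0) * (m / 2 * ‖b - a‖ ^ 2))) :=
    (Continuous.tendsto (by fun_prop) 0).mono_left nhdsWithin_le_nhds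
  have hlimit := le_of_tendsto hlim
    (eventually_of_mem (Ioo_mem_nhdsGT (zero_lt_one' ℝ)) hsegment)
  linarith

variable {α E : Type*} [MeasurableSpace α] [MeasurableSpace E] {S : Set E} {f : α → E → ℝ}

theorem exists_measurable_approx_minimizer [TopologicalSpace E] [SecondCountableTopology E]
    (hS : S.Nonempty) (hmeas : ∀ β, Measurable fun a => f a β) (hcont : ∀ a, Continuous (f a))
    (hbdd : ∀ a, BddBelow (f a '' S)) {ε : ℝ} (hε : 0 < ε) :
    ∃ v : α → E, Measurable v ∧ ∀ a, v a ∈ S ∧ ∀ β ∈ S, f a (v a) ≤ f a β + ε := by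
  classical
  have : Nonempty S := hS.to_subtype
  let u := TopologicalSpace.denseSeq S
  have hex : ∀ a, ∃ i, ∀ j, f a (u i) ≤ f a (u j) + ε := by
    intro a
    have hbdd' : BddBelow (Set.range fun i => f a (u i)) :=
      (hbdd a).mono (Set.range_subset_iff.2 fun i => Set.mem_image_of_mem (f a) (u i).2)
    obtain ⟨i, hi⟩ := exists_lt_of_ciInf_lt (lt_add_of_pos_right (⨅ i, f a (u i)) hε)
    exact ⟨i, fun j => hi.le.trans (by gcongr; exact ciInf_le hbdd' j)⟩
  refine ⟨fun a => u (Nat.find (hex a)),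
    Measurable.find (f := fun i _ => (u i : E)) (fun _ => measurable_const) (fun i => ?_) hex,
    fun a => ⟨(u _).2, fun β hβ => ?_⟩⟩
  · rw [Set.ofPred_forall]
    exact .iInter fun j => measurableSet_le (hmeas _) ((hmeas _).add_const ε)
  · exact (TopologicalSpace.denseRange_denseSeq S).induction_on
      (p := fun β : S => f a (u (Nat.find (hex a))) ≤ f a β + ε) ⟨β, hβ⟩
      (isClosed_le continuous_const
        (((hcont a).comp continuous_subtype_val).add continuous_const))
      (Nat.find_spec (hex a))

theorem measurable_of_quadratic_growth [PseudoMetricSpace E] [SecondCountableTopology E]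
    [BorelSpace E] (hmeas : ∀ β, Measurable fun a => f a β) (hcont : ∀ a, Continuous (f a))
    {b : α → E} {c : ℝ} (hc : 0 < c) (hb : ∀ a, b a ∈ S)
    (hgrowth : ∀ a, ∀ β ∈ S, f a (b a) + c * dist β (b a) ^ 2 ≤ f a β) : Measurable b := by
  rcases isEmpty_or_nonempty α with hα | ⟨⟨a₀⟩⟩
  · exact measurable_of_empty b
  have hbdd : ∀ a, BddBelow (f a '' S) := fun a =>
    ⟨f a (b a), Set.forall_mem_image.2 fun β hβ =>
      (le_add_of_nonneg_right (by positivity)).trans (hgrowth a β hβ)⟩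
  choose v hv_meas hv using fun k : ℕ => exists_measurable_approx_minimizer ⟨b a₀, hb a₀⟩ hmeas
    hcont hbdd (ε := 1 / ((k : ℝ) + 1)) (by positivity)
  refine measurable_of_tendsto_metrizable hv_meas (tendsto_pi_nhds.2 fun a => ?_)
  have hdist : ∀ k, dist (v k a) (b a) ≤ √(c⁻¹ * (1 / ((k : ℝ) + 1))) := by
    intro k
    have hle := (hv k a).2 (b a) (hb a)
    have hge := hgrowth a (v k a) (hv k a).1
    refine Real.le_sqrt_of_sq_le ?_
    rw [inv_mul_eq_div, le_div_iff₀ hc]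
    linarith
  rw [tendsto_iff_dist_tendsto_zero]
  refine squeeze_zero (fun _ => dist_nonneg) hdist ?_
  simpa using (tendsto_one_div_add_atTop_nhds_zero_nat.const_mul c⁻¹).sqrt

end Minimization

section Estimator

/-- The assumptions on the constraint set, regularizer, loss and risk that the argument uses:
`Problem.Admissible` without Lipschitz continuity of the regularizer and without the covariance. -/
structure Problem.Regular {p : ℕ} (P : Problem p) (s C B : ℝ) : Prop where
  isClosed : IsClosed P.Θ
  convex : Convex ℝ P.Θ
  anchor : ∃ β₀ ∈ P.Θ, ‖β₀‖ ^ 2 ≤ B * p ∧ P.r₀ β₀ ≤ B * p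
  reg_nonneg : ∀ β, 0 ≤ P.r₀ β
  reg_convex : ConvexOn ℝ Set.univ P.r₀
  loss : AdmissibleLoss s C P.loss
  risk : AdmissibleLoss s C P.risk

theorem Problem.Admissible.regular {p : ℕ} {P : Problem p} {s C C_X B : ℝ}
    (hP : P.Admissible s C C_X B) : P.Regular s C B :=
  { hP with }

theorem AdmissibleLoss.differentiable {s C : ℝ} {f : ℝ → ℝ → ℝ} (hf : AdmissibleLoss s C f)
    (y : ℝ) : Differentiable ℝ (f y) := (hf.contDiff y).differentiable one_ne_zero

variable {n p : ℕ} {P : Problem p} {lam η s C B : ℝ} {J : Finset (Fin n)}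

theorem Problem.Regular.continuous_objective (hP : P.Regular s C B) (D : Fin n → Obs p) :
    Continuous (P.objective lam η J D) := by
  have hreg : Continuous P.r₀ := hP.reg_convex.locallyLipschitz.continuous
  unfold Problem.objective Problem.regularizer
  refine (continuous_finsetSum _ fun j _ => ?_).add (by fun_prop)
  exact (hP.loss.contDiff _).continuous.comp (by fun_prop)

theorem Problem.Regular.strongConvexOn_objective (hP : P.Regular s C B) (hlam : 0 < lam)
    (hη : η ∈ Set.Ioc 0 1) (D : Fin n → Obs p) :
    StrongConvexOn P.Θ (2 * (lam * η)) (P.objective lam η J D) := by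
  have hloss : ∀ j, ConvexOn ℝ Set.univ fun β : EuclideanSpace ℝ (Fin p) =>
      P.loss (D j).2 (inner ℝ (D j).1 β) := fun j =>
    (hP.loss.convex (D j).2).comp_linearMap (innerSL ℝ (D j).1).toLinearMap
  have hsum : ConvexOn ℝ Set.univ fun β => ∑ j ∈ J, P.loss (D j).2 (inner ℝ (D j).1 β) := by
    induction J using Finset.induction_on with
    | empty => simpa only [Finset.sum_empty] using convexOn_const (0 : ℝ) convex_univ
    | insert j J hj ih =>
      simp only [Finset.sum_insert hj]
      exact (hloss j).add ih
  have hreg : ConvexOn ℝ Set.univ fun β => lam * (1 - η) * P.r₀ β :=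
    hP.reg_convex.smul (mul_nonneg hlam.le (sub_nonneg.2 hη.2))
  rw [strongConvexOn_iff_convex]
  refine ((hsum.add hreg).subset (Set.subset_univ _) hP.convex).congr fun β _ => ?_
  simp only [Problem.objective, Problem.regularizer, Pi.add_apply]
  ring

theorem Problem.Regular.mul_sq_norm_le_objective (hP : P.Regular s C B) (hlam : 0 < lam)
    (hη : η ∈ Set.Ioc 0 1) (D : Fin n → Obs p) (β : EuclideanSpace ℝ (Fin p)) :
    lam * η * ‖β‖ ^ 2 ≤ P.objective lam η J D β := by
  have hloss : 0 ≤ ∑ j ∈ J, P.loss (D j).2 (inner ℝ (D j).1 β) :=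
    Finset.sum_nonneg fun j _ => hP.loss.nonneg _ _
  have hreg : 0 ≤ lam * ((1 - η) * P.r₀ β) :=
    mul_nonneg hlam.le (mul_nonneg (sub_nonneg.2 hη.2) (hP.reg_nonneg β))
  simp only [Problem.objective, Problem.regularizer]
  linarith

theorem Problem.Regular.exists_isMinOn (hP : P.Regular s C B) (hlam : 0 < lam)
    (hη : η ∈ Set.Ioc 0 1) (D : Fin n → Obs p) :
    ∃ β, β ∈ P.Θ ∧ IsMinOn (P.objective lam η J D) P.Θ β := by
  obtain ⟨β₀, hβ₀, -⟩ := hP.anchor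
  have hcoercive : Tendsto (P.objective lam η J D) (cocompact _) atTop :=
    tendsto_atTop_mono (hP.mul_sq_norm_le_objective hlam hη D)
      (((tendsto_pow_atTop two_ne_zero).comp tendsto_norm_cocompact_atTop).const_mul_atTop
        (mul_pos hlam hη.1))
  exact (hP.continuous_objective D).continuousOn.exists_isMinOn' hP.isClosed hβ₀
    ((hcoercive.eventually (eventually_ge_atTop _)).filter_mono inf_le_left)

theorem Problem.Regular.estimate_spec (hP : P.Regular s C B) (hlam : 0 < lam)
    (hη : η ∈ Set.Ioc 0 1) (D : Fin n → Obs p) :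
    P.estimate lam η J D ∈ P.Θ ∧ IsMinOn (P.objective lam η J D) P.Θ (P.estimate lam η J D) :=
  Classical.epsilon_spec (hP.exists_isMinOn hlam hη D)

theorem Problem.Regular.objective_estimate_add_le (hP : P.Regular s C B) (hlam : 0 < lam)
    (hη : η ∈ Set.Ioc 0 1) (D : Fin n → Obs p) {β : EuclideanSpace ℝ (Fin p)} (hβ : β ∈ P.Θ) :
    P.objective lam η J D (P.estimate lam η J D) + lam * η * ‖β - P.estimate lam η J D‖ ^ 2 ≤
      P.objective lam η J D β := by
  have hspec := hP.estimate_spec hlam hη (J := J) D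
  have hgrowth := add_sq_norm_sub_le_of_isMinOn (hP.strongConvexOn_objective hlam hη D)
    hspec.1 hβ hspec.2
  rwa [mul_div_cancel_left₀ _ (two_ne_zero' ℝ)] at hgrowth

theorem Problem.Regular.measurable_estimate (hP : P.Regular s C B) (hlam : 0 < lam)
    (hη : η ∈ Set.Ioc 0 1) : Measurable (P.estimate lam η J) := by
  refine measurable_of_quadratic_growth (f := P.objective lam η J) (fun β => ?_)
    hP.continuous_objective (mul_pos hlam hη.1) (fun D => (hP.estimate_spec hlam hη D).1)
    (fun D β hβ => ?_)
  · unfold Problem.objective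
    refine (Finset.measurable_sum _ fun j _ => ?_).add_const _
    have hpair : Measurable fun D : Fin n → Obs p => ((D j).2, inner ℝ (D j).1 β) := by fun_prop
    exact hP.loss.measurable.comp hpair
  · rw [dist_eq_norm]
    exact hP.objective_estimate_add_le hlam hη D hβ

theorem Problem.dependsOn_estimate (P : Problem p) (lam η : ℝ) :
    DependsOn (P.estimate lam η J) J := by
  intro D D' hD
  have hobjective : P.objective lam η J D = P.objective lam η J D' := by
    funext β
    unfold Problem.objective
    exact congrArg (· + _) (Finset.sum_congr rfl fun j hj => by rw [hD j hj])
  unfold Problem.estimate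
  rw [hobjective]

theorem Problem.Regular.norm_estimate_sub_le (hP : P.Regular s C B) (hlam : 0 < lam)
    (hη : η ∈ Set.Ioc 0 1) {j : Fin n} (hj : j ∉ J) (D : Fin n → Obs p) :
    ‖P.estimate lam η J D - P.estimate lam η (insert j J) D‖ ≤
      (2 * (lam * η))⁻¹ *
        (|deriv (P.loss (D j).2) (inner ℝ (D j).1 (P.estimate lam η J D))| * ‖(D j).1‖) := by
  set a := P.estimate lam η J D
  set b := P.estimate lam η (insert j J) D
  set x := (D j).1
  set g := deriv (P.loss (D j).2) (inner ℝ x a)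
  have hpos : 0 < 2 * (lam * η) := mul_pos two_pos (mul_pos hlam hη.1)
  -- Adding the two growth inequalities cancels everything except the loss of the observation `j`.
  have hgrowth_a : P.objective lam η J D a + lam * η * ‖b - a‖ ^ 2 ≤ P.objective lam η J D b :=
    hP.objective_estimate_add_le hlam hη D (hP.estimate_spec hlam hη D).1
  have hgrowth_b : P.objective lam η (insert j J) D b + lam * η * ‖a - b‖ ^ 2 ≤
      P.objective lam η (insert j J) D a :=
    hP.objective_estimate_add_le hlam hη D (hP.estimate_spec hlam hη D).1
  have hconvex := sub_le_deriv_mul_sub (hP.loss.convex (D j).2)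
    (hP.loss.differentiable _ (inner ℝ x a)) (inner ℝ x b)
  have hcauchy : g * (inner ℝ x a - inner ℝ x b) ≤ |g| * (‖x‖ * ‖a - b‖) := by
    rw [← inner_sub_right]
    refine (le_abs_self _).trans ?_
    rw [abs_mul]
    gcongr
    exact abs_real_inner_le_norm _ _
  have hsq : (2 * (lam * η) * ‖a - b‖) * ‖a - b‖ ≤ (|g| * ‖x‖) * ‖a - b‖ := by
    simp only [Problem.objective, Finset.sum_insert hj] at hgrowth_a hgrowth_b
    rw [norm_sub_rev] at hgrowth_a
    linarith
  rw [inv_mul_eq_div, le_div_iff₀' hpos]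
  rcases (norm_nonneg (a - b)).eq_or_lt with hzero | hlt
  · rw [← hzero, mul_zero]
    positivity
  · exact le_of_mul_le_mul_right hsq hlt

theorem Problem.Regular.sq_norm_estimate_le (hP : P.Regular s C B) (hlam : 0 < lam)
    (hη : η ∈ Set.Ioc 0 1) {β₀ : EuclideanSpace ℝ (Fin p)} (hβ₀ : β₀ ∈ P.Θ)
    (hnorm : ‖β₀‖ ^ 2 ≤ B * p) (hreg : P.r₀ β₀ ≤ B * p) (D : Fin n → Obs p) :
    lam * η * ‖P.estimate lam η J D‖ ^ 2 ≤
      ∑ j ∈ J, P.loss (D j).2 (inner ℝ (D j).1 β₀) + lam * (B * p) := by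
  have hregularizer : P.regularizer η β₀ ≤ B * p := by
    have h1 := mul_le_mul_of_nonneg_left hreg (sub_nonneg.2 hη.2)
    have h2 := mul_le_mul_of_nonneg_left hnorm hη.1.le
    unfold Problem.regularizer
    linarith
  calc lam * η * ‖P.estimate lam η J D‖ ^ 2
      ≤ P.objective lam η J D (P.estimate lam η J D) :=
        hP.mul_sq_norm_le_objective hlam hη D _
    _ ≤ P.objective lam η J D β₀ := (hP.estimate_spec hlam hη D).2 hβ₀
    _ ≤ _ := add_le_add_right (mul_le_mul_of_nonneg_left hregularizer hlam.le) _

end Estimator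

section LpNorm

variable {α β F : Type*} [MeasurableSpace α] [MeasurableSpace β] [NormedAddCommGroup F]
  {μ : Measure α}

theorem eLpNorm_abs_rpow_le [IsProbabilityMeasure μ] (f : α → ℝ) (s : ℝ≥0) (q : ℝ≥0∞) :
    eLpNorm (fun x => |f x| ^ (s : ℝ)) q μ ≤ eLpNorm f (q * s) μ ^ (s : ℝ) := by
  rcases eq_or_ne s 0 with rfl | hs
  · rcases eq_or_ne q 0 with rfl | hq
    · simp
    · simp [eLpNorm_const _ hq (IsProbabilityMeasure.ne_zero μ)]
  · have hnorm := eLpNorm_norm_rpow (p := q) (μ := μ) f (NNReal.coe_pos.2 (pos_iff_ne_zero.2 hs))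
    rw [ENNReal.ofReal_coe_nnreal] at hnorm
    exact hnorm.le

theorem eLpNorm_norm_sq (f : α → F) (q : ℝ≥0∞) :
    eLpNorm (fun x => ‖f x‖ ^ 2) q μ = eLpNorm f (2 * q) μ ^ 2 := by
  have hnorm := eLpNorm_norm_rpow (p := q) (μ := μ) f two_pos
  rw [ENNReal.ofReal_ofNat, ENNReal.rpow_two, mul_comm] at hnorm
  simpa only [Real.rpow_two] using hnorm

theorem eLpNorm_mul_le {f g : α → ℝ} (hf : AEStronglyMeasurable f μ)
    (hg : AEStronglyMeasurable g μ) (q : ℝ≥0∞) :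
    eLpNorm (fun x => f x * g x) q μ ≤ eLpNorm f (2 * q) μ * eLpNorm g (2 * q) μ := by
  have : ENNReal.HolderTriple (2 * q) (2 * q) q := ⟨by
    rw [ENNReal.mul_inv (.inl two_ne_zero) (.inl ENNReal.ofNat_ne_top), ← add_mul,
      ENNReal.inv_two_add_inv_two, one_mul]⟩
  change eLpNorm (f • g) q μ ≤ _
  exact eLpNorm_smul_le_mul_eLpNorm hg hf

theorem eLpNorm_le_coe_mul {f : α → F} {g : α → ℝ} {c : ℝ≥0} (hfg : ∀ x, ‖f x‖ ≤ c * g x)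
    (q : ℝ≥0∞) : eLpNorm f q μ ≤ c * eLpNorm g q μ := by
  simpa only [ENNReal.ofReal_coe_nnreal] using eLpNorm_le_mul_eLpNorm_of_ae_le_mul
    (.of_forall fun x => (hfg x).trans (mul_le_mul_of_nonneg_left (le_abs_self _) c.2)) q

theorem eLpNorm_mean_le {ι : Type*} [Fintype ι] {T : ι → α → ℝ} {q : ℝ≥0∞}
    (hT : ∀ i, AEStronglyMeasurable (T i) μ) (hq1 : 1 ≤ q) {c : ℝ≥0}
    (hc : ∀ i, eLpNorm (T i) q μ ≤ c) :
    eLpNorm (fun x => (1 / (Fintype.card ι : ℝ)) * ∑ i, T i x) q μ ≤ c := by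
  set N := Fintype.card ι
  have hsum : eLpNorm (∑ i, T i) q μ ≤ N * c :=
    calc eLpNorm (∑ i, T i) q μ
        ≤ ∑ _i : ι, (c : ℝ≥0∞) :=
          (eLpNorm_sum_le (fun i _ => hT i) hq1).trans (Finset.sum_le_sum fun i _ => hc i)
      _ = N * c := by simp [N]
  calc eLpNorm (fun x => (1 / (N : ℝ)) * ∑ i, T i x) q μ
      ≤ ((N : ℝ≥0)⁻¹ : ℝ≥0) * eLpNorm (fun x => ‖(∑ i, T i) x‖) q μ :=
        eLpNorm_le_coe_mul (fun x => by simp [Finset.sum_apply]) q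
    _ = ((N : ℝ≥0)⁻¹ : ℝ≥0) * eLpNorm (∑ i, T i) q μ := by rw [eLpNorm_norm]
    _ ≤ ((N : ℝ≥0)⁻¹ : ℝ≥0) * (N * c) := by gcongr
    _ = ((N : ℝ≥0)⁻¹ * N * c : ℝ≥0) := by push_cast; rw [mul_assoc]
    _ ≤ c := ENNReal.coe_le_coe.2 (mul_le_of_le_one_left' inv_mul_le_one)

theorem abs_integral_mul_le {f g : α → ℝ} (hf : AEStronglyMeasurable f μ)
    (hg : AEStronglyMeasurable g μ) {a b : ℝ≥0} (hfa : eLpNorm f 2 μ ≤ a)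
    (hgb : eLpNorm g 2 μ ≤ b) : |∫ x, f x * g x ∂μ| ≤ a * b := by
  have henorm : ‖∫ x, f x * g x ∂μ‖ₑ ≤ (a * b : ℝ≥0) :=
    calc ‖∫ x, f x * g x ∂μ‖ₑ
        ≤ eLpNorm (fun x => f x * g x) 1 μ :=
          (enorm_integral_le_lintegral_enorm _).trans_eq eLpNorm_one_eq_lintegral_enorm.symm
      _ ≤ eLpNorm f 2 μ * eLpNorm g 2 μ := by simpa only [mul_one] using eLpNorm_mul_le hf hg 1
      _ ≤ (a * b : ℝ≥0) := by
          rw [ENNReal.coe_mul]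
          gcongr
  rw [← NNReal.coe_mul, ← Real.norm_eq_abs]
  exact_mod_cast henorm

theorem integral_sq_le {f : α → ℝ} (hf : AEStronglyMeasurable f μ) {a : ℝ≥0}
    (hfa : eLpNorm f 2 μ ≤ a) : ∫ x, f x ^ 2 ∂μ ≤ (a : ℝ) ^ 2 := by
  simp only [sq]
  exact (le_abs_self _).trans (abs_integral_mul_le hf hf hfa hfa)

theorem integral_sq_add_le {f g : α → ℝ} (hf : MemLp f 2 μ) (hg : MemLp g 2 μ) :
    ∫ x, (f x + g x) ^ 2 ∂μ ≤ 2 * (∫ x, f x ^ 2 ∂μ + ∫ x, g x ^ 2 ∂μ) := by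
  rw [← integral_add hf.integrable_sq hg.integrable_sq, ← integral_const_mul]
  exact integral_mono (hf.add hg).integrable_sq
    ((hf.integrable_sq.add hg.integrable_sq).const_mul 2) fun x => add_sq_le

theorem memLp_of_eLpNorm_le {f : α → F} (hf : AEStronglyMeasurable f μ) {q : ℝ≥0∞} {c : ℝ≥0}
    (hc : eLpNorm f q μ ≤ c) : MemLp f q μ :=
  ⟨hf, hc.trans_lt ENNReal.coe_lt_top⟩

section Product

variable {ν : Measure β} [SFinite ν] {f : α × β → F} {q : ℝ≥0∞}

theorem eLpNorm_prod (hf : AEStronglyMeasurable f (μ.prod ν)) (hq : q ≠ ∞) :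
    eLpNorm f q (μ.prod ν) = eLpNorm (fun x => eLpNorm (fun z => f (x, z)) q ν) q μ := by
  rcases eq_or_ne q 0 with rfl | hq0
  · simp
  have hpos : 0 < q.toReal := ENNReal.toReal_pos hq0 hq
  simp only [eLpNorm_eq_lintegral_rpow_enorm_toReal hq0 hq, enorm_eq_self, ← ENNReal.rpow_mul,
    one_div_mul_cancel hpos.ne', ENNReal.rpow_one]
  rw [lintegral_prod _ (hf.enorm.pow_const _)]

theorem eLpNorm_prod_le_mul {G : Type*} [NormedAddCommGroup G]
    (hf : AEStronglyMeasurable f (μ.prod ν)) (hq : q ≠ ∞) {c : ℝ≥0} {b : α → G}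
    (hfiber : ∀ x, eLpNorm (fun z => f (x, z)) q ν ≤ c * ‖b x‖ₑ) :
    eLpNorm f q (μ.prod ν) ≤ c * eLpNorm b q μ := by
  rw [eLpNorm_prod hf hq]
  exact eLpNorm_le_mul_eLpNorm_of_ae_le_mul' (.of_forall hfiber) q

theorem eLpNorm_integral_le [NormedSpace ℝ F] [IsProbabilityMeasure ν]
    (hf : StronglyMeasurable f) (hq : q ≠ ∞) (hq1 : 1 ≤ q) :
    eLpNorm (fun x => ∫ z, f (x, z) ∂ν) q μ ≤ eLpNorm f q (μ.prod ν) := by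
  rw [eLpNorm_prod hf.aestronglyMeasurable hq]
  refine eLpNorm_mono_enorm fun x => ?_
  calc ‖∫ z, f (x, z) ∂ν‖ₑ
      ≤ eLpNorm (fun z => f (x, z)) 1 ν :=
        (enorm_integral_le_lintegral_enorm _).trans_eq eLpNorm_one_eq_lintegral_enorm.symm
    _ ≤ eLpNorm (fun z => f (x, z)) q ν :=
        eLpNorm_le_eLpNorm_of_exponent_le hq1
          (hf.comp_measurable measurable_prodMk_left).aestronglyMeasurable

end Product

end LpNorm

section Resampling

theorem integral_sq_mean_le {ι α : Type*} [Fintype ι] [MeasurableSpace α] {μ : Measure α}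
    {T : ι → α → ℝ} (hT : ∀ i, MemLp (T i) 2 μ) {a b : ℝ} (hb : 0 ≤ b)
    (hdiag : ∀ i, ∫ x, T i x ^ 2 ∂μ ≤ a)
    (hoff : ∀ i j, i ≠ j → ∫ x, T i x * T j x ∂μ ≤ b) :
    ∫ x, ((1 / (Fintype.card ι : ℝ)) * ∑ i, T i x) ^ 2 ∂μ ≤ a / Fintype.card ι + b := by
  classical
  set N : ℝ := (Fintype.card ι : ℝ)
  have hint : ∀ i j, Integrable (fun x => T i x * T j x) μ :=
    fun i j => (hT i).integrable_mul (hT j)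
  have hentry : ∀ i j, ∫ x, T i x * T j x ∂μ ≤ (if i = j then a else 0) + b := by
    intro i j
    split_ifs with hij
    · subst hij
      simpa only [← sq] using (hdiag i).trans (le_add_of_nonneg_right hb)
    · simpa only [zero_add] using hoff i j hij
  calc ∫ x, ((1 / N) * ∑ i, T i x) ^ 2 ∂μ
      = (1 / N) ^ 2 * ∑ i, ∑ j, ∫ x, T i x * T j x ∂μ := by
        simp only [mul_pow, sq (∑ i, T i _), Finset.sum_mul_sum, integral_const_mul]
        rw [integral_finsetSum _ fun i _ => integrable_finsetSum _ fun j _ => hint i j]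
        simp only [integral_finsetSum _ fun j _ => hint _ j]
    _ ≤ (1 / N) ^ 2 * ∑ i : ι, ∑ j : ι, ((if i = j then a else 0) + b) := by
        gcongr
        exact hentry _ _
    _ = (1 / N) ^ 2 * (N * a + N ^ 2 * b) := by
        simp only [Finset.sum_add_distrib, Finset.sum_ite_eq, Finset.mem_univ, if_true,
          Finset.sum_const, Finset.card_univ, nsmul_eq_mul, N]
        ring
    _ ≤ a / N + b := by
        rcases eq_or_ne N 0 with hN | hN
        · simp [hN, hb]
        · exact le_of_eq (by field_simp)

variable {ι : Type*} [DecidableEq ι] {E : ι → Type*} [∀ i, MeasurableSpace (E i)]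
  {ν : ∀ i, Measure (E i)} {f g h : (∀ i, E i) → ℝ} {i j : ι} {q : ℝ≥0∞}

/-- The average of `f` over an independent redraw of the `j`-th coordinate, i.e. the conditional
expectation of `f` given all the other coordinates. -/
noncomputable def coordAvg (ν : ∀ i, Measure (E i)) (j : ι) (f : (∀ i, E i) → ℝ)
    (D : ∀ i, E i) : ℝ :=
  ∫ z, f (Function.update D j z) ∂ν j

/-- The part of `f` that its average over the `j`-th coordinate does not see. -/
noncomputable def fluctuation (ν : ∀ i, Measure (E i)) (j : ι) (f : (∀ i, E i) → ℝ)
    (D : ∀ i, E i) : ℝ :=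
  f D - coordAvg ν j f D

theorem dependsOn_coordAvg {S : Set ι} (hf : DependsOn f S) : DependsOn (coordAvg ν j f) S :=
  fun D D' hD => integral_congr_ae <| .of_forall fun z => hf fun i hi => by
    rcases eq_or_ne i j with rfl | hij
    · simp
    · simp [hij, hD i hi]

theorem dependsOn_fluctuation {S : Set ι} (hf : DependsOn f S) :
    DependsOn (fluctuation ν j f) S :=
  fun _ _ hD => congrArg₂ (· - ·) (hf hD) (dependsOn_coordAvg hf hD)

variable [∀ i, IsProbabilityMeasure (ν i)]

theorem measurable_coordAvg (hf : Measurable f) : Measurable (coordAvg ν j f) :=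
  (StronglyMeasurable.integral_prod_right (f := fun D z => f (Function.update D j z))
    (hf.comp measurable_update').stronglyMeasurable).measurable

theorem measurable_fluctuation (hf : Measurable f) : Measurable (fluctuation ν j f) :=
  hf.sub (measurable_coordAvg hf)

variable [Fintype ι]

theorem measurePreserving_update (ν : ∀ i, Measure (E i)) [∀ i, IsProbabilityMeasure (ν i)]
    (j : ι) : MeasurePreserving (fun a : (∀ i, E i) × E j => Function.update a.1 j a.2)
      ((Measure.pi ν).prod (ν j)) (Measure.pi ν) := by
  refine ⟨measurable_update', Measure.ext_of_lintegral _ fun f hf => ?_⟩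
  have hcomp : Measurable fun a : (∀ i, E i) × E j => f (Function.update a.1 j a.2) :=
    hf.comp measurable_update'
  rw [lintegral_map hf measurable_update', lintegral_prod _ hcomp.aemeasurable]
  refine lintegral_eq_of_lmarginal_eq {j} hcomp.lintegral_prod_right' hf ?_
  simp [lmarginal_singleton]

omit [DecidableEq ι] in
theorem eLpNorm_apply_eq_prod {f : (∀ i, E i) → E j → ℝ}
    (hf : Measurable (Function.uncurry f)) (hdep : DependsOn f {j}ᶜ) :
    eLpNorm (fun D => f D (D j)) q (Measure.pi ν) =
      eLpNorm (Function.uncurry f) q ((Measure.pi ν).prod (ν j)) := by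
  classical
  have hmeas : Measurable fun D => f D (D j) :=
    hf.comp (measurable_id.prodMk (measurable_pi_apply j))
  rw [← eLpNorm_comp_measurePreserving hmeas.aestronglyMeasurable (measurePreserving_update ν j)]
  congr 1
  funext a
  have hupdate : f (Function.update a.1 j a.2) = f a.1 :=
    hdep fun i hi => Function.update_of_ne hi a.2 a.1
  simp only [Function.comp_apply, Function.update_self, hupdate, Function.uncurry]

theorem eLpNorm_coordAvg_le (hf : Measurable f) (hq : q ≠ ∞) (hq1 : 1 ≤ q) :
    eLpNorm (coordAvg ν j f) q (Measure.pi ν) ≤ eLpNorm f q (Measure.pi ν) := by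
  rw [← eLpNorm_comp_measurePreserving hf.aestronglyMeasurable (measurePreserving_update ν j)]
  exact eLpNorm_integral_le (f := f ∘ fun a : (∀ i, E i) × E j => Function.update a.1 j a.2)
    (hf.comp measurable_update').stronglyMeasurable hq hq1

theorem memLp_coordAvg (hf : Measurable f) (hfq : MemLp f q (Measure.pi ν)) (hq : q ≠ ∞)
    (hq1 : 1 ≤ q) : MemLp (coordAvg ν j f) q (Measure.pi ν) :=
  ⟨(measurable_coordAvg hf).aestronglyMeasurable, (eLpNorm_coordAvg_le hf hq hq1).trans_lt hfq.2⟩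

theorem eLpNorm_fluctuation_le (hf : Measurable f) (hq : q ≠ ∞) (hq1 : 1 ≤ q) {c : ℝ≥0}
    (hfc : eLpNorm f q (Measure.pi ν) ≤ c) :
    eLpNorm (fluctuation ν j f) q (Measure.pi ν) ≤ (2 * c : ℝ≥0) :=
  calc eLpNorm (fluctuation ν j f) q (Measure.pi ν)
      ≤ eLpNorm f q (Measure.pi ν) + eLpNorm (coordAvg ν j f) q (Measure.pi ν) :=
        eLpNorm_sub_le hf.aestronglyMeasurable (measurable_coordAvg hf).aestronglyMeasurable hq1
    _ ≤ c + c := add_le_add hfc ((eLpNorm_coordAvg_le hf hq hq1).trans hfc)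
    _ = (2 * c : ℝ≥0) := by rw [two_mul, ENNReal.coe_add]

theorem memLp_fluctuation (hf : Measurable f) (hfq : MemLp f q (Measure.pi ν)) (hq : q ≠ ∞)
    (hq1 : 1 ≤ q) : MemLp (fluctuation ν j f) q (Measure.pi ν) :=
  hfq.sub (memLp_coordAvg hf hfq hq hq1)

theorem fluctuation_sub_ae_eq (hf : Integrable f (Measure.pi ν))
    (hg : Integrable g (Measure.pi ν)) :
    fluctuation ν j (f - g) =ᵐ[Measure.pi ν] fluctuation ν j f - fluctuation ν j g := by
  have hmp := measurePreserving_update ν j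
  filter_upwards [((hmp.integrable_comp hf.1).2 hf).prod_right_ae,
    ((hmp.integrable_comp hg.1).2 hg).prod_right_ae] with D hfD hgD
  have havg : coordAvg ν j (f - g) D = coordAvg ν j f D - coordAvg ν j g D :=
    integral_sub hfD hgD
  simp only [fluctuation, Pi.sub_apply, havg]
  ring

theorem integral_mul_fluctuation_eq_zero (hg : Measurable g) (hg2 : MemLp g 2 (Measure.pi ν))
    (hh2 : MemLp h 2 (Measure.pi ν)) (hdep : DependsOn h {j}ᶜ) :
    ∫ D, h D * fluctuation ν j g D ∂Measure.pi ν = 0 := by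
  have hmp := measurePreserving_update ν j
  have hint : Integrable (fun D => h D * g D) (Measure.pi ν) := hh2.integrable_mul hg2
  have hint_avg : Integrable (fun D => h D * coordAvg ν j g D) (Measure.pi ν) :=
    hh2.integrable_mul (memLp_coordAvg hg hg2 ENNReal.ofNat_ne_top one_le_two)
  have hupdate : ∀ D z, h (Function.update D j z) = h D :=
    fun D z => hdep fun i hi => Function.update_of_ne hi z D
  have hredraw : ∫ D, h D * g D ∂Measure.pi ν = ∫ D, h D * coordAvg ν j g D ∂Measure.pi ν :=
    calc ∫ D, h D * g D ∂Measure.pi ν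
        = ∫ a, h (Function.update a.1 j a.2) * g (Function.update a.1 j a.2)
            ∂(Measure.pi ν).prod (ν j) := by
          conv_lhs => rw [← hmp.map_eq]
          exact integral_map hmp.aemeasurable (hmp.map_eq.symm ▸ hint.1)
      _ = ∫ D, h D * coordAvg ν j g D ∂Measure.pi ν := by
          refine (integral_prod _ ((hmp.integrable_comp hint.1).2 hint)).trans ?_
          simp only [Function.comp_apply, hupdate, integral_const_mul, coordAvg]
  simp only [fluctuation, mul_sub]
  rw [integral_sub hint hint_avg, hredraw, sub_self]

theorem integral_fluctuation_mul_fluctuation_sub {g' : (∀ i, E i) → ℝ} (hf : Measurable f)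
    (hg : Measurable g) (hg' : Measurable g') (hf2 : MemLp f 2 (Measure.pi ν))
    (hg2 : MemLp g 2 (Measure.pi ν)) (hg'2 : MemLp g' 2 (Measure.pi ν)) (hdep : DependsOn g' {i}ᶜ) :
    ∫ D, fluctuation ν i f D * fluctuation ν j (g - g') D ∂Measure.pi ν =
      ∫ D, fluctuation ν i f D * fluctuation ν j g D ∂Measure.pi ν := by
  have hfi := memLp_fluctuation (j := i) hf hf2 ENNReal.ofNat_ne_top one_le_two
  have hgj := memLp_fluctuation (j := j) hg hg2 ENNReal.ofNat_ne_top one_le_two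
  have hg'j := memLp_fluctuation (j := j) hg' hg'2 ENNReal.ofNat_ne_top one_le_two
  have hzero : ∫ D, fluctuation ν i f D * fluctuation ν j g' D ∂Measure.pi ν = 0 := by
    simp only [mul_comm (fluctuation ν i f _)]
    exact integral_mul_fluctuation_eq_zero hf hf2 hg'j (dependsOn_fluctuation hdep)
  calc ∫ D, fluctuation ν i f D * fluctuation ν j (g - g') D ∂Measure.pi ν
      = ∫ D, (fluctuation ν i f D * fluctuation ν j g D -
          fluctuation ν i f D * fluctuation ν j g' D) ∂Measure.pi ν := by
        refine integral_congr_ae ?_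
        filter_upwards [fluctuation_sub_ae_eq (j := j) (hg2.integrable one_le_two)
          (hg'2.integrable one_le_two)] with D hD
        rw [hD, Pi.sub_apply, mul_sub]
    _ = ∫ D, fluctuation ν i f D * fluctuation ν j g D ∂Measure.pi ν := by
        refine (integral_sub (hfi.integrable_mul hgj) (hfi.integrable_mul hg'j)).trans ?_
        exact (congrArg _ hzero).trans (sub_zero _)

theorem abs_integral_fluctuation_mul_fluctuation_le {f' g' : (∀ i, E i) → ℝ} {a b : ℝ≥0}
    (hf : Measurable f) (hg : Measurable g) (hf' : Measurable f') (hg' : Measurable g')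
    (hf2 : MemLp f 2 (Measure.pi ν)) (hg2 : MemLp g 2 (Measure.pi ν))
    (hf'dep : DependsOn f' {j}ᶜ) (hg'dep : DependsOn g' {i}ᶜ)
    (hfa : eLpNorm (f - f') 2 (Measure.pi ν) ≤ a) (hgb : eLpNorm (g - g') 2 (Measure.pi ν) ≤ b) :
    |∫ D, fluctuation ν i f D * fluctuation ν j g D ∂Measure.pi ν| ≤
      2 * (a : ℝ) * (2 * (b : ℝ)) := by
  have hsubf := hf.sub hf'
  have hsubg := hg.sub hg'
  have hsubf2 := memLp_of_eLpNorm_le hsubf.aestronglyMeasurable hfa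
  have hsubg2 := memLp_of_eLpNorm_le hsubg.aestronglyMeasurable hgb
  have hf'2 : MemLp f' 2 (Measure.pi ν) := by simpa using hf2.sub hsubf2
  have hg'2 : MemLp g' 2 (Measure.pi ν) := by simpa using hg2.sub hsubg2
  have hreplace : ∫ D, fluctuation ν i f D * fluctuation ν j g D ∂Measure.pi ν =
      ∫ D, fluctuation ν i (f - f') D * fluctuation ν j (g - g') D ∂Measure.pi ν := by
    rw [integral_fluctuation_mul_fluctuation_sub hsubf hg hg' hsubf2 hg2 hg'2 hg'dep]
    simp only [mul_comm (fluctuation ν i _ _)]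
    rw [integral_fluctuation_mul_fluctuation_sub hg hf hf' hg2 hf2 hf'2 hf'dep]
  rw [hreplace]
  simpa only [NNReal.coe_mul, NNReal.coe_ofNat] using abs_integral_mul_le
    (measurable_fluctuation hsubf).aestronglyMeasurable
    (measurable_fluctuation hsubg).aestronglyMeasurable
    (eLpNorm_fluctuation_le hsubf ENNReal.ofNat_ne_top one_le_two hfa)
    (eLpNorm_fluctuation_le hsubg ENNReal.ofNat_ne_top one_le_two hgb)

theorem integral_sq_mean_fluctuation_le {F : ι → (∀ i, E i) → ℝ} {F' : ι → ι → (∀ i, E i) → ℝ}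
    {a b : ℝ≥0} (hF : ∀ i, Measurable (F i)) (hF' : ∀ i j, Measurable (F' i j))
    (hdep : ∀ i j, i ≠ j → DependsOn (F' i j) {j}ᶜ)
    (hFa : ∀ i, eLpNorm (F i) 2 (Measure.pi ν) ≤ a)
    (hFb : ∀ i j, i ≠ j → eLpNorm (F i - F' i j) 2 (Measure.pi ν) ≤ b) :
    ∫ D, ((1 / (Fintype.card ι : ℝ)) * ∑ i, fluctuation ν i (F i) D) ^ 2 ∂Measure.pi ν ≤
      (2 * (a : ℝ)) ^ 2 / (Fintype.card ι : ℝ) + 2 * (b : ℝ) * (2 * (b : ℝ)) := by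
  have hF2 : ∀ i, MemLp (F i) 2 (Measure.pi ν) :=
    fun i => memLp_of_eLpNorm_le (hF i).aestronglyMeasurable (hFa i)
  refine integral_sq_mean_le
    (fun i => memLp_fluctuation (hF i) (hF2 i) ENNReal.ofNat_ne_top one_le_two) (by positivity)
    (fun i => ?_) (fun i j hij => (le_abs_self _).trans ?_)
  · simpa only [NNReal.coe_mul, NNReal.coe_ofNat] using
      integral_sq_le (measurable_fluctuation (hF i)).aestronglyMeasurable
        (eLpNorm_fluctuation_le (hF i) ENNReal.ofNat_ne_top one_le_two (hFa i))
  · exact abs_integral_fluctuation_mul_fluctuation_le (hF i) (hF j) (hF' i j) (hF' j i)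
      (hF2 i) (hF2 j) (hdep i j hij) (hdep j i hij.symm) (hFb i j hij) (hFb j i hij.symm)

end Resampling

section Moments

/-- The normalization `p ^ (-1/2)`: linear functionals of norm one of the features have size
`scale p`, while estimates have norm of order `(scale p)⁻¹`. -/
noncomputable def scale (p : ℕ) : ℝ≥0 := (NNReal.sqrt p)⁻¹

theorem sq_scale (p : ℕ) : scale p ^ 2 = (p : ℝ≥0)⁻¹ := by
  rw [scale, inv_pow, NNReal.sq_sqrt]

theorem sq_scale_mul_le_one (p : ℕ) : scale p ^ 2 * p ≤ 1 := by
  rw [sq_scale]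
  exact inv_mul_le_one

theorem sq_scale_mul_le {n p : ℕ} {γ : ℝ≥0} (hn : n ≤ γ * p) : scale p ^ 2 * n ≤ γ := by
  calc scale p ^ 2 * n ≤ scale p ^ 2 * (γ * p) := by gcongr
    _ = γ * (scale p ^ 2 * p) := by ring
    _ ≤ γ := mul_le_of_le_one_right' (sq_scale_mul_le_one p)

/-- The quantities on which the error bound depends. Besides the parameters of the problem these
are bounds `G q` and `H q` for the `L^q` norms of normalized features and of responses. -/
structure Constants where
  /-- upper bound for the ratio of sample size and dimension -/
  γ : ℝ≥0
  /-- order of the growth of the loss and the risk -/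
  s : ℝ≥0
  /-- constant in the growth of the loss and the risk -/
  C : ℝ≥0
  /-- size of the anchor of the constraint set -/
  B : ℝ≥0
  /-- strength of the regularization -/
  lam : ℝ≥0
  /-- weight of the quadratic part of the regularizer -/
  η : ℝ≥0
  lam_pos : 0 < (lam : ℝ)
  η_mem : (η : ℝ) ∈ Set.Ioc 0 1
  /-- `L^q` bounds for the normalized features -/
  G : ℝ≥0∞ → ℝ≥0
  /-- `L^q` bounds for the responses -/
  H : ℝ≥0∞ → ℝ≥0

/-- The moment assumptions on the law `ν` of an observation: linear functionals of the features
have `L^q` norm at most `p ^ (-1/2) G q` times their operator norm, responses at most `H q`. -/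
structure Constants.IsLaw (K : Constants) {p : ℕ} (ν : Measure (Obs p)) : Prop where
  isProbabilityMeasure : IsProbabilityMeasure ν
  features : ∀ q : ℝ≥0∞, q ≠ ∞ → ∀ v : EuclideanSpace ℝ (Fin p),
    eLpNorm (fun z : Obs p => inner ℝ z.1 v) q ν ≤ (scale p * K.G q : ℝ≥0) * ‖v‖ₑ
  responses : ∀ q : ℝ≥0∞, q ≠ ∞ → eLpNorm (fun z : Obs p => z.2) q ν ≤ K.H q

/-- The growth function `1 + |y|^s + |xᵀβ|^s` of the losses, at an observation `z = (x, y)`. -/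
noncomputable def polyWeight {p : ℕ} (s : ℝ) (β : EuclideanSpace ℝ (Fin p)) (z : Obs p) : ℝ :=
  1 + |z.2| ^ s + |inner ℝ z.1 β| ^ s

/-- A bound for the `L^q` norm of `polyWeight` on a fresh observation, when the normalized
estimate has `L^(q s)` norm at most `r`. -/
noncomputable def Constants.weight (K : Constants) (q : ℝ≥0∞) (r : ℝ≥0) : ℝ≥0 :=
  1 + K.H (q * K.s) ^ (K.s : ℝ) + (K.G (q * K.s) * r) ^ (K.s : ℝ)

/-- A bound for the `L^q` norm of the normalized estimate. The exponent `q + 1 ≥ 1` makes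
Minkowski's inequality available for the squared norm. -/
noncomputable def Constants.radius (K : Constants) (q : ℝ≥0∞) : ℝ≥0 :=
  NNReal.sqrt ((K.γ * (K.C * K.weight (q + 1) (NNReal.sqrt K.B)) + K.lam * K.B) / (K.lam * K.η))

/-- A bound for the `L^q` norm of the growth function along the estimates. -/
noncomputable def Constants.estimateWeight (K : Constants) (q : ℝ≥0∞) : ℝ≥0 :=
  K.weight q (K.radius (q * K.s))

/-- A bound for the `L^q` norm of the change of the estimate caused by one observation. -/
noncomputable def Constants.stability (K : Constants) (q : ℝ≥0∞) : ℝ≥0 :=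
  (2 * (K.lam * K.η))⁻¹ * K.C * (K.estimateWeight (2 * q) * K.G (2 * q))

/-- A bound for `p ^ (1/2)` times the `L^q` norm of the change of the risk on a fresh observation
caused by one training observation. -/
noncomputable def Constants.riskStability (K : Constants) (q : ℝ≥0∞) : ℝ≥0 :=
  K.C * (2 * K.estimateWeight (2 * q) * (K.G (2 * q) * K.stability (2 * q)))

variable {K : Constants} {p : ℕ} {ν : Measure (Obs p)} {q : ℝ≥0∞}

theorem measurable_polyWeight {α : Type*} [MeasurableSpace α] {s : ℝ}
    {b : α → EuclideanSpace ℝ (Fin p)} {z : α → Obs p} (hb : Measurable b) (hz : Measurable z) :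
    Measurable fun a => polyWeight s (b a) (z a) := by
  unfold polyWeight
  fun_prop

theorem Constants.IsLaw.eLpNorm_inner_le (hν : K.IsLaw ν) {α : Type*} [MeasurableSpace α]
    {ρ : Measure α} {b : α → EuclideanSpace ℝ (Fin p)} (hb : Measurable b) (hq : q ≠ ∞) :
    eLpNorm (fun a : α × Obs p => inner ℝ a.2.1 (b a.1)) q (ρ.prod ν) ≤
      (scale p * K.G q : ℝ≥0) * eLpNorm b q ρ :=
  have := hν.isProbabilityMeasure
  eLpNorm_prod_le_mul (by fun_prop) hq fun a => hν.features q hq (b a)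

theorem Constants.IsLaw.eLpNorm_polyWeight_le (hν : K.IsLaw ν) {α : Type*} [MeasurableSpace α]
    {ρ : Measure α} [IsProbabilityMeasure ρ] {b : α → EuclideanSpace ℝ (Fin p)}
    (hb : Measurable b) (hq : q ≠ ∞) (hq1 : 1 ≤ q) {r : ℝ≥0}
    (hr : scale p * eLpNorm b (q * K.s) ρ ≤ r) :
    eLpNorm (fun a : α × Obs p => polyWeight K.s (b a.1) a.2) q (ρ.prod ν) ≤ K.weight q r := by
  have := hν.isProbabilityMeasure
  have hqs : q * K.s ≠ ∞ := ENNReal.mul_ne_top hq ENNReal.coe_ne_top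
  have hone : eLpNorm (fun _ : α × Obs p => (1 : ℝ)) q (ρ.prod ν) ≤ 1 := by
    rw [eLpNorm_const _ (zero_lt_one.trans_le hq1).ne' (IsProbabilityMeasure.ne_zero _)]
    simp
  have hresponse : eLpNorm (fun a : α × Obs p => |a.2.2| ^ (K.s : ℝ)) q (ρ.prod ν) ≤
      (K.H (q * K.s) : ℝ≥0∞) ^ (K.s : ℝ) := by
    refine (eLpNorm_abs_rpow_le _ _ _).trans ?_
    gcongr
    refine le_of_eq_of_le ?_ (hν.responses _ hqs)
    exact eLpNorm_comp_measurePreserving (f := Prod.snd) (g := fun z : Obs p => z.2)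
      (by fun_prop) measurePreserving_snd
  have hfeature : eLpNorm (fun a : α × Obs p => |inner ℝ a.2.1 (b a.1)| ^ (K.s : ℝ)) q
      (ρ.prod ν) ≤ ((K.G (q * K.s) : ℝ≥0∞) * r) ^ (K.s : ℝ) := by
    refine (eLpNorm_abs_rpow_le _ _ _).trans ?_
    gcongr
    refine (hν.eLpNorm_inner_le hb hqs).trans ?_
    rw [ENNReal.coe_mul, mul_comm (scale p : ℝ≥0∞), mul_assoc]
    gcongr
  calc eLpNorm (fun a : α × Obs p => polyWeight K.s (b a.1) a.2) q (ρ.prod ν)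
      ≤ 1 + (K.H (q * K.s) : ℝ≥0∞) ^ (K.s : ℝ) + ((K.G (q * K.s) : ℝ≥0∞) * r) ^ (K.s : ℝ) := by
        have hs := K.s.coe_nonneg
        refine (eLpNorm_add_le ?_ ?_ hq1).trans (add_le_add ((eLpNorm_add_le ?_ ?_ hq1).trans
          (add_le_add hone hresponse)) hfeature) <;> fun_prop (disch := assumption)
    _ = K.weight q r := by
        simp only [Constants.weight, ENNReal.coe_add, ENNReal.coe_one,
          ENNReal.coe_rpow_of_nonneg _ K.s.coe_nonneg,
          ENNReal.coe_mul]

theorem Constants.IsLaw.eLpNorm_norm_features_le (hν : K.IsLaw ν) (hq : q ≠ ∞) (hq1 : 1 ≤ q) :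
    eLpNorm (fun z : Obs p => ‖z.1‖) (2 * q) ν ≤ K.G (2 * q) := by
  have h2q : 2 * q ≠ ∞ := ENNReal.mul_ne_top ENNReal.ofNat_ne_top hq
  have hcoord : ∀ l, eLpNorm (fun z : Obs p => z.1 l) (2 * q) ν ≤
      (scale p * K.G (2 * q) : ℝ≥0) := fun l => by
    simpa [EuclideanSpace.inner_single_right, ← ofReal_norm] using
      hν.features (2 * q) h2q (EuclideanSpace.single l 1)
  rw [eLpNorm_norm, ← ENNReal.pow_le_pow_left_iff two_ne_zero]
  calc eLpNorm (fun z : Obs p => z.1) (2 * q) ν ^ 2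
      = eLpNorm (∑ l, fun z : Obs p => ‖z.1 l‖ ^ 2) q ν := by
        rw [← eLpNorm_norm_sq]
        congr 1
        funext z
        simp only [EuclideanSpace.norm_sq_eq, Finset.sum_apply]
    _ ≤ ∑ l : Fin p, eLpNorm (fun z : Obs p => z.1 l) (2 * q) ν ^ 2 := by
        simp only [← eLpNorm_norm_sq]
        exact eLpNorm_sum_le (fun l _ => by fun_prop) hq1
    _ ≤ ∑ _l : Fin p, ((scale p * K.G (2 * q) : ℝ≥0) : ℝ≥0∞) ^ 2 := by
        gcongr
        exact hcoord _
    _ = ((scale p ^ 2 * p * K.G (2 * q) ^ 2 : ℝ≥0) : ℝ≥0∞) := by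
        simp only [Finset.sum_const, Finset.card_univ, Fintype.card_fin, nsmul_eq_mul]
        push_cast
        ring
    _ ≤ K.G (2 * q) ^ 2 := by
        exact_mod_cast mul_le_of_le_one_left' (sq_scale_mul_le_one p)

end Moments

section Stability

variable {K : Constants} {n p : ℕ} {P : Problem p} {ν : Measure (Obs p)} {q : ℝ≥0∞}
  {J : Finset (Fin n)}

theorem Constants.IsLaw.eLpNorm_loss_le (hν : K.IsLaw ν) (hP : P.Regular K.s K.C K.B)
    (hq : q ≠ ∞) (hq1 : 1 ≤ q) {β₀ : EuclideanSpace ℝ (Fin p)} (hβ₀ : ‖β₀‖ ^ 2 ≤ K.B * p)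
    (j : Fin n) :
    eLpNorm (fun D : Fin n → Obs p => P.loss (D j).2 (inner ℝ (D j).1 β₀)) q
      (Measure.pi fun _ => ν) ≤ (K.C * K.weight q (NNReal.sqrt K.B) : ℝ≥0) := by
  have := hν.isProbabilityMeasure
  have hnorm : scale p * ‖β₀‖₊ ≤ NNReal.sqrt K.B := by
    rw [NNReal.le_sqrt_iff_sq_le, mul_pow]
    calc scale p ^ 2 * ‖β₀‖₊ ^ 2 ≤ scale p ^ 2 * (K.B * p) := by
          gcongr
          exact_mod_cast hβ₀
      _ = scale p ^ 2 * p * K.B := by ring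
      _ ≤ K.B := mul_le_of_le_one_left' (sq_scale_mul_le_one p)
  have hanchor : scale p * eLpNorm (fun _ : Fin n → Obs p => β₀) (q * K.s)
      (Measure.pi fun _ => ν) ≤ (NNReal.sqrt K.B : ℝ≥0) := by
    refine (mul_le_mul_right (eLpNorm_le_of_ae_bound (C := ‖β₀‖) (.of_forall fun _ => le_rfl))
      _).trans ?_
    simp only [measure_univ, ENNReal.one_rpow, one_mul, ofReal_norm, enorm_eq_nnnorm]
    exact_mod_cast hnorm
  calc eLpNorm (fun D : Fin n → Obs p => P.loss (D j).2 (inner ℝ (D j).1 β₀)) q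
        (Measure.pi fun _ => ν)
      ≤ K.C * eLpNorm (fun D : Fin n → Obs p => polyWeight K.s β₀ (D j)) q
          (Measure.pi fun _ => ν) := eLpNorm_le_coe_mul (fun D => hP.loss.growth _ _) q
    _ ≤ K.C * K.weight q (NNReal.sqrt K.B) := by
        gcongr
        rw [eLpNorm_apply_eq_prod (j := j) (f := fun (_ : Fin n → Obs p) z => polyWeight K.s β₀ z)
          (measurable_polyWeight measurable_const measurable_snd) fun _ _ _ => rfl]
        exact hν.eLpNorm_polyWeight_le measurable_const hq hq1 hanchor
    _ = _ := (ENNReal.coe_mul _ _).symm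

theorem Constants.IsLaw.eLpNorm_estimate_sq_le (hν : K.IsLaw ν) (hP : P.Regular K.s K.C K.B)
    (hq : q ≠ ∞) (hq1 : 1 ≤ q) :
    (K.lam * K.η) * eLpNorm (P.estimate K.lam K.η J) (2 * q) (Measure.pi fun _ => ν) ^ 2 ≤
      (n * (K.C * K.weight q (NNReal.sqrt K.B)) + K.lam * (K.B * p) : ℝ≥0) := by
  have := hν.isProbabilityMeasure
  obtain ⟨β₀, hβ₀, hnorm, hreg⟩ := hP.anchor
  set π := Measure.pi fun _ : Fin n => ν
  set w : ℝ≥0 := K.C * K.weight q (NNReal.sqrt K.B)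
  set loss : Fin n → (Fin n → Obs p) → ℝ := fun j D => P.loss (D j).2 (inner ℝ (D j).1 β₀)
  set c : ℝ≥0 := K.lam * (K.B * p)
  have hloss_meas : ∀ j, AEStronglyMeasurable (loss j) π := fun j => by
    have hpair : Measurable fun D : Fin n → Obs p => ((D j).2, inner ℝ (D j).1 β₀) := by fun_prop
    exact (hP.loss.measurable.comp hpair).aestronglyMeasurable
  calc (K.lam * K.η) * eLpNorm (P.estimate K.lam K.η J) (2 * q) π ^ 2
      = eLpNorm (((K.lam * K.η : ℝ≥0) : ℝ) • fun D => ‖P.estimate K.lam K.η J D‖ ^ 2) q π := by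
        rw [eLpNorm_const_smul, eLpNorm_norm_sq, Real.enorm_of_nonneg (K.lam * K.η).coe_nonneg,
          ENNReal.ofReal_coe_nnreal, ENNReal.coe_mul]
    _ ≤ eLpNorm ((∑ j ∈ J, loss j) + fun _ => (c : ℝ)) q π := by
        refine eLpNorm_mono_real fun D => ?_
        rw [Real.norm_of_nonneg (by simp only [Pi.smul_apply]; positivity)]
        simpa [loss, c] using hP.sq_norm_estimate_le K.lam_pos K.η_mem hβ₀ hnorm hreg D
    _ ≤ (∑ j ∈ J, eLpNorm (loss j) q π) + c := by
        refine (eLpNorm_add_le (Finset.aestronglyMeasurable_sum _ fun j _ => hloss_meas j)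
          (by fun_prop) hq1).trans (add_le_add (eLpNorm_sum_le (fun j _ => hloss_meas j) hq1) ?_)
        rw [eLpNorm_const _ (zero_lt_one.trans_le hq1).ne' (IsProbabilityMeasure.ne_zero _)]
        simp
    _ ≤ (∑ _j : Fin n, (w : ℝ≥0∞)) + c := by
        gcongr
        exact (Finset.sum_le_sum_of_subset (Finset.subset_univ J)).trans
          (Finset.sum_le_sum fun j _ => hν.eLpNorm_loss_le hP hq hq1 hnorm j)
    _ = (n * w + c : ℝ≥0) := by simp

theorem Constants.IsLaw.scale_mul_eLpNorm_estimate_le (hν : K.IsLaw ν)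
    (hP : P.Regular K.s K.C K.B) (hn : n ≤ K.γ * p) (hq : q ≠ ∞) :
    scale p * eLpNorm (P.estimate K.lam K.η J) q (Measure.pi fun _ => ν) ≤ K.radius q := by
  have := hν.isProbabilityMeasure
  set π := Measure.pi fun _ : Fin n => ν
  set w : ℝ≥0 := K.C * K.weight (q + 1) (NNReal.sqrt K.B)
  have hq' : q + 1 ≠ ∞ := ENNReal.add_ne_top.2 ⟨hq, ENNReal.one_ne_top⟩
  have hlamη : 0 < K.lam * K.η := mul_pos K.lam_pos K.η_mem.1
  have hsq := hν.eLpNorm_estimate_sq_le hP (J := J) hq' le_add_self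
  have hexponent : q ≤ 2 * (q + 1) := by
    rw [two_mul]
    exact le_self_add.trans le_self_add
  refine (mul_le_mul_right (eLpNorm_le_eLpNorm_of_exponent_le hexponent
    (hP.measurable_estimate K.lam_pos K.η_mem).aestronglyMeasurable) _).trans ?_
  change K.lam * K.η * eLpNorm (P.estimate K.lam K.η J) (2 * (q + 1)) π ^ 2 ≤ _ at hsq
  generalize eLpNorm (P.estimate K.lam K.η J) (2 * (q + 1)) π = e at hsq ⊢
  lift e to ℝ≥0 using by
    rintro rfl
    simp [← ENNReal.coe_mul, hlamη.ne'] at hsq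
  norm_cast at hsq ⊢
  rw [Constants.radius, NNReal.le_sqrt_iff_sq_le, le_div_iff₀ hlamη]
  calc (scale p * e) ^ 2 * (K.lam * K.η)
      = scale p ^ 2 * (K.lam * K.η * e ^ 2) := by ring
    _ ≤ scale p ^ 2 * (n * w + K.lam * (K.B * p)) := by gcongr
    _ = scale p ^ 2 * n * w + scale p ^ 2 * p * (K.lam * K.B) := by ring
    _ ≤ K.γ * w + K.lam * K.B := add_le_add (mul_le_mul_left (sq_scale_mul_le hn) w)
        (mul_le_of_le_one_left' (sq_scale_mul_le_one p))

theorem Constants.IsLaw.eLpNorm_estimateWeight_le (hν : K.IsLaw ν)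
    (hP : P.Regular K.s K.C K.B) (hn : n ≤ K.γ * p) (hq : q ≠ ∞) (hq1 : 1 ≤ q) :
    eLpNorm (fun a : (Fin n → Obs p) × Obs p => polyWeight K.s (P.estimate K.lam K.η J a.1) a.2) q
      ((Measure.pi fun _ => ν).prod ν) ≤ K.estimateWeight q :=
  have := hν.isProbabilityMeasure
  hν.eLpNorm_polyWeight_le (hP.measurable_estimate K.lam_pos K.η_mem) hq hq1
    (hν.scale_mul_eLpNorm_estimate_le hP hn (ENNReal.mul_ne_top hq ENNReal.coe_ne_top))

theorem Constants.IsLaw.eLpNorm_estimate_sub_le (hν : K.IsLaw ν) (hP : P.Regular K.s K.C K.B)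
    (hn : n ≤ K.γ * p) (hq : q ≠ ∞) (hq1 : 1 ≤ q) {j : Fin n} (hj : j ∉ J) :
    eLpNorm (fun D => P.estimate K.lam K.η J D - P.estimate K.lam K.η (insert j J) D) q
      (Measure.pi fun _ => ν) ≤ K.stability q := by
  have := hν.isProbabilityMeasure
  have hmeas := hP.measurable_estimate K.lam_pos K.η_mem (J := J)
  have hweight : Measurable fun a : (Fin n → Obs p) × Obs p =>
      polyWeight K.s (P.estimate K.lam K.η J a.1) a.2 :=
    measurable_polyWeight (hmeas.comp measurable_fst) measurable_snd
  have h2q : 2 * q ≠ ∞ := ENNReal.mul_ne_top ENNReal.ofNat_ne_top hq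
  set bound : (Fin n → Obs p) → Obs p → ℝ := fun D z =>
    polyWeight K.s (P.estimate K.lam K.η J D) z * ‖z.1‖
  have hdep : DependsOn bound {j}ᶜ := fun D D' hD => by
    simp only [bound, P.dependsOn_estimate K.lam K.η fun i hi => hD i fun hij => hj (hij ▸ hi)]
  calc eLpNorm (fun D => P.estimate K.lam K.η J D - P.estimate K.lam K.η (insert j J) D) q
        (Measure.pi fun _ => ν)
      ≤ ((2 * (K.lam * K.η))⁻¹ * K.C : ℝ≥0) *
          eLpNorm (fun D => bound D (D j)) q (Measure.pi fun _ => ν) := by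
        refine eLpNorm_le_coe_mul (fun D => ?_) q
        refine (hP.norm_estimate_sub_le K.lam_pos K.η_mem hj D).trans ?_
        push_cast
        rw [mul_assoc, ← mul_assoc (K.C : ℝ)]
        gcongr
        exact hP.loss.growth_deriv _ _
    _ = ((2 * (K.lam * K.η))⁻¹ * K.C : ℝ≥0) *
          eLpNorm (Function.uncurry bound) q ((Measure.pi fun _ => ν).prod ν) := by
        rw [eLpNorm_apply_eq_prod (by fun_prop) hdep]
    _ ≤ ((2 * (K.lam * K.η))⁻¹ * K.C : ℝ≥0) *
          (K.estimateWeight (2 * q) * K.G (2 * q)) := by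
        gcongr
        refine (eLpNorm_mul_le hweight.aestronglyMeasurable (by fun_prop) q).trans ?_
        refine mul_le_mul' (hν.eLpNorm_estimateWeight_le hP hn h2q
          (hq1.trans (le_mul_of_one_le_left' one_le_two))) ?_
        refine le_of_eq_of_le ?_ (hν.eLpNorm_norm_features_le hq hq1)
        exact eLpNorm_comp_measurePreserving (f := Prod.snd) (g := fun z : Obs p => ‖z.1‖)
          (by fun_prop) measurePreserving_snd
    _ = K.stability q := by
        simp only [Constants.stability, ENNReal.coe_mul]

end Stability

section Risk

variable {n p : ℕ} {P : Problem p} {ν : Measure (Obs p)} {lam η s C B : ℝ} {J : Finset (Fin n)}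
  {i j : Fin n}

/-- The risk at the observation `z` of the estimate based on the observations with index in `J`. -/
noncomputable def Problem.freshRisk (P : Problem p) (lam η : ℝ) (J : Finset (Fin n))
    (D : Fin n → Obs p) (z : Obs p) : ℝ :=
  P.risk z.2 (inner ℝ z.1 (P.estimate lam η J D))

/-- The expected risk on a fresh observation of the estimate based on the observations in `J`. -/
noncomputable def Problem.meanRisk (P : Problem p) (lam η : ℝ) (ν : Measure (Obs p))
    (J : Finset (Fin n)) (D : Fin n → Obs p) : ℝ :=
  ∫ z, P.freshRisk lam η J D z ∂ν

/-- The risk, at the `i`-th training observation, of the estimate based on the observations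
in `J`. -/
noncomputable def Problem.riskAt (P : Problem p) (lam η : ℝ) (J : Finset (Fin n)) (i : Fin n)
    (D : Fin n → Obs p) : ℝ :=
  P.freshRisk lam η J D (D i)

/-- The difference between the leave-one-out estimate and the out-of-sample risk, as a function of
the training set. -/
noncomputable def Problem.looError (P : Problem p) (lam η : ℝ) (ν : Measure (Obs p))
    (D : Fin n → Obs p) : ℝ :=
  (1 / (n : ℝ)) * ∑ i, P.riskAt lam η (Finset.univ.erase i) i D -
    P.meanRisk lam η ν Finset.univ D

theorem Problem.dependsOn_freshRisk (P : Problem p) (lam η : ℝ) (hj : j ∉ J) :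
    DependsOn (P.freshRisk lam η J) {j}ᶜ := fun D D' hD => by
  unfold Problem.freshRisk
  rw [P.dependsOn_estimate lam η fun i hi => hD i fun hij => hj (hij ▸ hi)]

theorem Problem.dependsOn_riskAt (P : Problem p) (lam η : ℝ) (hij : i ≠ j) (hj : j ∉ J) :
    DependsOn (P.riskAt lam η J i) {j}ᶜ := fun D D' hD => by
  unfold Problem.riskAt
  rw [P.dependsOn_freshRisk lam η hj hD, hD i hij]

theorem Problem.coordAvg_riskAt (P : Problem p) (lam η : ℝ) (hi : i ∉ J) :
    coordAvg (fun _ => ν) i (P.riskAt lam η J i) = P.meanRisk lam η ν J := by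
  funext D
  have hupdate : ∀ z, P.freshRisk lam η J (Function.update D i z) = P.freshRisk lam η J D :=
    fun z => P.dependsOn_freshRisk lam η hi fun k hk => Function.update_of_ne hk z D
  simp only [coordAvg, Problem.riskAt, hupdate, Function.update_self, Problem.meanRisk]

theorem Problem.looError_eq_fluctuation_add (P : Problem p) (lam η : ℝ) (hn : n ≠ 0)
    (D : Fin n → Obs p) :
    P.looError lam η ν D =
      (1 / (n : ℝ)) *
          ∑ i, fluctuation (fun _ => ν) i (P.riskAt lam η (Finset.univ.erase i) i) D +
        (1 / (n : ℝ)) * ∑ i : Fin n,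
          (P.meanRisk lam η ν (Finset.univ.erase i) D - P.meanRisk lam η ν Finset.univ D) := by
  simp only [fluctuation, P.coordAvg_riskAt lam η (Finset.notMem_erase _ _)]
  rw [← mul_add, ← Finset.sum_add_distrib]
  simp only [Problem.looError, sub_add_sub_cancel, Finset.sum_sub_distrib, Finset.sum_const,
    Finset.card_univ, Fintype.card_fin, nsmul_eq_mul]
  field_simp

theorem Problem.Regular.measurable_freshRisk (hP : P.Regular s C B) (hlam : 0 < lam)
    (hη : η ∈ Set.Ioc 0 1) : Measurable (Function.uncurry (P.freshRisk lam η J)) := by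
  have hestimate := hP.measurable_estimate hlam hη (J := J)
  have hpair : Measurable fun a : (Fin n → Obs p) × Obs p =>
      (a.2.2, inner ℝ a.2.1 (P.estimate lam η J a.1)) := by fun_prop
  exact hP.risk.measurable.comp hpair

theorem Problem.Regular.measurable_riskAt (hP : P.Regular s C B) (hlam : 0 < lam)
    (hη : η ∈ Set.Ioc 0 1) : Measurable (P.riskAt lam η J i) :=
  (hP.measurable_freshRisk hlam hη).comp (measurable_id.prodMk (measurable_pi_apply i))

theorem Problem.Regular.measurable_meanRisk [SFinite ν] (hP : P.Regular s C B) (hlam : 0 < lam)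
    (hη : η ∈ Set.Ioc 0 1) : Measurable (P.meanRisk lam η ν J) :=
  (StronglyMeasurable.integral_prod_right (f := P.freshRisk lam η J)
    (hP.measurable_freshRisk hlam hη).stronglyMeasurable).measurable

theorem Problem.Regular.measurable_looError [SFinite ν] (hP : P.Regular s C B) (hlam : 0 < lam)
    (hη : η ∈ Set.Ioc 0 1) : Measurable (P.looError (n := n) lam η ν) :=
  ((Finset.measurable_sum _ fun _ _ => hP.measurable_riskAt hlam hη).const_mul _).sub
    (hP.measurable_meanRisk hlam hη)

theorem AdmissibleLoss.abs_sub_le {f : ℝ → ℝ → ℝ} (hf : AdmissibleLoss s C f) (z : Obs p)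
    (a b : EuclideanSpace ℝ (Fin p)) :
    |f z.2 (inner ℝ z.1 a) - f z.2 (inner ℝ z.1 b)| ≤
      C * ((polyWeight s a z + polyWeight s b z) * |inner ℝ z.1 (a - b)|) := by
  have hstep : ∀ u v : EuclideanSpace ℝ (Fin p), f z.2 (inner ℝ z.1 u) - f z.2 (inner ℝ z.1 v) ≤
      C * polyWeight s u z * |inner ℝ z.1 (u - v)| := fun u v => by
    rw [inner_sub_right]
    refine (sub_le_deriv_mul_sub (hf.convex z.2) (hf.differentiable _ _) _).trans ?_
    refine (le_abs_self _).trans ?_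
    rw [abs_mul]
    gcongr
    exact hf.growth_deriv _ _
  have hweight : ∀ u, 0 ≤ C * polyWeight s u z * |inner ℝ z.1 (a - b)| := fun u =>
    mul_nonneg ((abs_nonneg _).trans (hf.growth z.2 (inner ℝ z.1 u))) (abs_nonneg _)
  have hab := hstep a b
  have hba := hstep b a
  rw [← neg_sub a b, inner_neg_right, abs_neg] at hba
  rw [abs_le]
  constructor <;> linarith [hweight a, hweight b]

end Risk

section LooError

variable {K : Constants} {n p : ℕ} {P : Problem p} {ν : Measure (Obs p)} {q : ℝ≥0∞}
  {J : Finset (Fin n)} {i j : Fin n}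

theorem Constants.IsLaw.eLpNorm_freshRisk_le (hν : K.IsLaw ν) (hP : P.Regular K.s K.C K.B)
    (hn : n ≤ K.γ * p) (hq : q ≠ ∞) (hq1 : 1 ≤ q) :
    eLpNorm (Function.uncurry (P.freshRisk K.lam K.η J)) q ((Measure.pi fun _ => ν).prod ν) ≤
      (K.C * K.estimateWeight q : ℝ≥0) := by
  rw [ENNReal.coe_mul]
  exact (eLpNorm_le_coe_mul (fun a => hP.risk.growth _ _) q).trans
    (mul_le_mul_right (hν.eLpNorm_estimateWeight_le hP hn hq hq1) _)

theorem Constants.IsLaw.eLpNorm_riskAt_le (hν : K.IsLaw ν) (hP : P.Regular K.s K.C K.B)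
    (hn : n ≤ K.γ * p) (hq : q ≠ ∞) (hq1 : 1 ≤ q) (hi : i ∉ J) :
    eLpNorm (P.riskAt K.lam K.η J i) q (Measure.pi fun _ => ν) ≤
      (K.C * K.estimateWeight q : ℝ≥0) := by
  have := hν.isProbabilityMeasure
  unfold Problem.riskAt
  rw [eLpNorm_apply_eq_prod (hP.measurable_freshRisk K.lam_pos K.η_mem)
    (P.dependsOn_freshRisk _ _ hi)]
  exact hν.eLpNorm_freshRisk_le hP hn hq hq1

theorem Constants.IsLaw.eLpNorm_inner_estimate_sub_le (hν : K.IsLaw ν)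
    (hP : P.Regular K.s K.C K.B) (hn : n ≤ K.γ * p) (hq : q ≠ ∞) (hq1 : 1 ≤ q) (hj : j ∉ J) :
    eLpNorm (fun a : (Fin n → Obs p) × Obs p => inner ℝ a.2.1
        (P.estimate K.lam K.η J a.1 - P.estimate K.lam K.η (insert j J) a.1)) q
      ((Measure.pi fun _ => ν).prod ν) ≤ (scale p * (K.G q * K.stability q) : ℝ≥0) := by
  rw [← mul_assoc, ENNReal.coe_mul]
  exact (hν.eLpNorm_inner_le ((hP.measurable_estimate K.lam_pos K.η_mem).sub
    (hP.measurable_estimate K.lam_pos K.η_mem)) hq).trans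
      (mul_le_mul_right (hν.eLpNorm_estimate_sub_le hP hn hq hq1 hj) _)

theorem Constants.IsLaw.eLpNorm_freshRisk_sub_le (hν : K.IsLaw ν) (hP : P.Regular K.s K.C K.B)
    (hn : n ≤ K.γ * p) (hq : q ≠ ∞) (hq1 : 1 ≤ q) (hj : j ∉ J) :
    eLpNorm (Function.uncurry (P.freshRisk K.lam K.η J - P.freshRisk K.lam K.η (insert j J))) q
      ((Measure.pi fun _ => ν).prod ν) ≤ (scale p * K.riskStability q : ℝ≥0) := by
  have := hν.isProbabilityMeasure
  have h2q : 2 * q ≠ ∞ := ENNReal.mul_ne_top ENNReal.ofNat_ne_top hq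
  have h2q1 : 1 ≤ 2 * q := hq1.trans (le_mul_of_one_le_left' one_le_two)
  set π := (Measure.pi fun _ : Fin n => ν).prod ν
  set weight : Finset (Fin n) → (Fin n → Obs p) × Obs p → ℝ :=
    fun I a => polyWeight K.s (P.estimate K.lam K.η I a.1) a.2
  set shift : (Fin n → Obs p) × Obs p → ℝ := fun a =>
    inner ℝ a.2.1 (P.estimate K.lam K.η J a.1 - P.estimate K.lam K.η (insert j J) a.1)
  have hestimate : ∀ I : Finset (Fin n), Measurable (P.estimate K.lam K.η I) :=
    fun I => hP.measurable_estimate K.lam_pos K.η_mem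
  have hweight_meas : ∀ I, AEStronglyMeasurable (weight I) π := fun I =>
    (measurable_polyWeight ((hestimate I).comp measurable_fst) measurable_snd).aestronglyMeasurable
  have hshift_meas : AEStronglyMeasurable (fun a => |shift a|) π := by fun_prop
  have hweight : eLpNorm (weight J + weight (insert j J)) (2 * q) π ≤
      (2 * K.estimateWeight (2 * q) : ℝ≥0) := by
    rw [two_mul (K.estimateWeight (2 * q)), ENNReal.coe_add]
    exact (eLpNorm_add_le (hweight_meas _) (hweight_meas _) h2q1).trans
      (add_le_add (hν.eLpNorm_estimateWeight_le hP hn h2q h2q1)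
        (hν.eLpNorm_estimateWeight_le hP hn h2q h2q1))
  have hshift : eLpNorm (fun a => |shift a|) (2 * q) π ≤
      (scale p * (K.G (2 * q) * K.stability (2 * q)) : ℝ≥0) :=
    (eLpNorm_norm shift).trans_le (hν.eLpNorm_inner_estimate_sub_le hP hn h2q h2q1 hj)
  calc eLpNorm (Function.uncurry (P.freshRisk K.lam K.η J - P.freshRisk K.lam K.η (insert j J))) q π
      ≤ K.C * eLpNorm (fun a => (weight J + weight (insert j J)) a * |shift a|) q π :=
        eLpNorm_le_coe_mul (fun a => hP.risk.abs_sub_le a.2 _ _) q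
    _ ≤ K.C * ((2 * K.estimateWeight (2 * q) : ℝ≥0) *
          (scale p * (K.G (2 * q) * K.stability (2 * q)) : ℝ≥0)) := by
        gcongr
        exact (eLpNorm_mul_le ((hweight_meas _).add (hweight_meas _)) hshift_meas q).trans
          (mul_le_mul' hweight hshift)
    _ = (scale p * K.riskStability q : ℝ≥0) := by
        unfold Constants.riskStability
        push_cast
        ring

theorem Constants.IsLaw.eLpNorm_riskAt_sub_le (hν : K.IsLaw ν) (hP : P.Regular K.s K.C K.B)
    (hn : n ≤ K.γ * p) (hq : q ≠ ∞) (hq1 : 1 ≤ q) (hi : i ∉ insert j J) (hj : j ∉ J) :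
    eLpNorm (P.riskAt K.lam K.η (insert j J) i - P.riskAt K.lam K.η J i) q
      (Measure.pi fun _ => ν) ≤ (scale p * K.riskStability q : ℝ≥0) := by
  have := hν.isProbabilityMeasure
  have hiJ : i ∉ J := fun h => hi (Finset.mem_insert_of_mem h)
  rw [eLpNorm_sub_comm]
  refine le_of_eq_of_le ?_ (hν.eLpNorm_freshRisk_sub_le hP hn hq hq1 hj)
  exact eLpNorm_apply_eq_prod
    (f := P.freshRisk K.lam K.η J - P.freshRisk K.lam K.η (insert j J))
    ((hP.measurable_freshRisk K.lam_pos K.η_mem).sub (hP.measurable_freshRisk K.lam_pos K.η_mem))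
    fun _ _ hD => congrArg₂ (· - ·) (P.dependsOn_freshRisk _ _ hiJ hD)
      (P.dependsOn_freshRisk _ _ hi hD)

theorem Constants.IsLaw.memLp_freshRisk (hν : K.IsLaw ν) (hP : P.Regular K.s K.C K.B)
    (hn : n ≤ K.γ * p) (hq : q ≠ ∞) (hq1 : 1 ≤ q) :
    MemLp (Function.uncurry (P.freshRisk K.lam K.η J)) q ((Measure.pi fun _ => ν).prod ν) :=
  memLp_of_eLpNorm_le (hP.measurable_freshRisk K.lam_pos K.η_mem).aestronglyMeasurable
    (hν.eLpNorm_freshRisk_le hP hn hq hq1)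

theorem Constants.IsLaw.eLpNorm_meanRisk_sub_le (hν : K.IsLaw ν) (hP : P.Regular K.s K.C K.B)
    (hn : n ≤ K.γ * p) (hq : q ≠ ∞) (hq1 : 1 ≤ q) (hj : j ∉ J) :
    eLpNorm (P.meanRisk K.lam K.η ν J - P.meanRisk K.lam K.η ν (insert j J)) q
      (Measure.pi fun _ => ν) ≤ (scale p * K.riskStability q : ℝ≥0) := by
  have := hν.isProbabilityMeasure
  have hint : ∀ J : Finset (Fin n), Integrable (Function.uncurry (P.freshRisk K.lam K.η J))
      ((Measure.pi fun _ => ν).prod ν) :=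
    fun J => (hν.memLp_freshRisk hP hn hq hq1).integrable hq1
  have hae : P.meanRisk K.lam K.η ν J - P.meanRisk K.lam K.η ν (insert j J)
      =ᵐ[Measure.pi fun _ => ν]
      fun D => ∫ z, (P.freshRisk K.lam K.η J - P.freshRisk K.lam K.η (insert j J)) D z ∂ν := by
    filter_upwards [(hint J).prod_right_ae, (hint (insert j J)).prod_right_ae] with D hD hD'
    exact (integral_sub hD hD').symm
  rw [eLpNorm_congr_ae hae]
  exact (eLpNorm_integral_le
    (f := Function.uncurry (P.freshRisk K.lam K.η J - P.freshRisk K.lam K.η (insert j J)))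
    ((hP.measurable_freshRisk K.lam_pos K.η_mem).sub
      (hP.measurable_freshRisk K.lam_pos K.η_mem)).stronglyMeasurable hq hq1).trans
    (hν.eLpNorm_freshRisk_sub_le hP hn hq hq1 hj)

/-- The constant in the bound `errorBound / n` for the mean squared error. -/
noncomputable def Constants.errorBound (K : Constants) : ℝ :=
  8 * (K.C * K.estimateWeight 2) ^ 2 + 10 * (K.γ * K.riskStability 2 ^ 2)

theorem Constants.IsLaw.integral_sq_mean_fluctuation_riskAt_le (hν : K.IsLaw ν)
    (hP : P.Regular K.s K.C K.B) (hn : n ≤ K.γ * p) :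
    ∫ D, ((1 / (n : ℝ)) * ∑ i, fluctuation (fun _ : Fin n => ν) i
        (P.riskAt K.lam K.η (Finset.univ.erase i) i) D) ^ 2 ∂Measure.pi (fun _ => ν) ≤
      (2 * (K.C * K.estimateWeight 2 : ℝ)) ^ 2 / n +
        (2 * (scale p * K.riskStability 2 : ℝ)) ^ 2 := by
  have := hν.isProbabilityMeasure
  have hmean := integral_sq_mean_fluctuation_le (ν := fun _ : Fin n => ν)
    (F := fun i => P.riskAt K.lam K.η (Finset.univ.erase i) i)
    (F' := fun i j => P.riskAt K.lam K.η ((Finset.univ.erase i).erase j) i)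
    (fun i => hP.measurable_riskAt K.lam_pos K.η_mem)
    (fun i j => hP.measurable_riskAt K.lam_pos K.η_mem)
    (fun i j hij => P.dependsOn_riskAt _ _ hij (Finset.notMem_erase _ _))
    (fun i => hν.eLpNorm_riskAt_le hP hn ENNReal.ofNat_ne_top one_le_two (Finset.notMem_erase _ _))
    (fun i j hij => by
      have herase : insert j ((Finset.univ.erase i).erase j) = Finset.univ.erase i :=
        Finset.insert_erase (Finset.mem_erase.2 ⟨hij.symm, Finset.mem_univ j⟩)
      have hsub := hν.eLpNorm_riskAt_sub_le hP hn ENNReal.ofNat_ne_top one_le_two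
        (herase ▸ Finset.notMem_erase i _) (Finset.notMem_erase j (Finset.univ.erase i))
      rwa [herase] at hsub)
  simpa only [Fintype.card_fin, ← sq, NNReal.coe_mul] using hmean

theorem Constants.IsLaw.eLpNorm_mean_meanRisk_sub_le (hν : K.IsLaw ν)
    (hP : P.Regular K.s K.C K.B) (hn : n ≤ K.γ * p) :
    eLpNorm (fun D => (1 / (n : ℝ)) * ∑ i : Fin n, (P.meanRisk K.lam K.η ν (Finset.univ.erase i) D -
        P.meanRisk K.lam K.η ν Finset.univ D)) 2 (Measure.pi fun _ => ν) ≤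
      (scale p * K.riskStability 2 : ℝ≥0) := by
  have := hν.isProbabilityMeasure
  have hsub : ∀ i : Fin n, eLpNorm (P.meanRisk K.lam K.η ν (Finset.univ.erase i) -
      P.meanRisk K.lam K.η ν Finset.univ) 2 (Measure.pi fun _ => ν) ≤
        (scale p * K.riskStability 2 : ℝ≥0) := fun i => by
    simpa only [Finset.insert_erase (Finset.mem_univ i)] using
      hν.eLpNorm_meanRisk_sub_le hP hn ENNReal.ofNat_ne_top one_le_two
        (Finset.notMem_erase i Finset.univ)
  simpa only [Fintype.card_fin, Pi.sub_apply] using eLpNorm_mean_le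
    (fun i => ((hP.measurable_meanRisk K.lam_pos K.η_mem).sub
      (hP.measurable_meanRisk K.lam_pos K.η_mem)).aestronglyMeasurable) one_le_two hsub

theorem Constants.IsLaw.memLp_looError (hν : K.IsLaw ν) (hP : P.Regular K.s K.C K.B)
    (hn : n ≤ K.γ * p) : MemLp (P.looError K.lam K.η ν) 2 (Measure.pi fun _ : Fin n => ν) := by
  have := hν.isProbabilityMeasure
  have hmean : MemLp (P.meanRisk K.lam K.η ν Finset.univ) 2 (Measure.pi fun _ : Fin n => ν) :=
    ⟨(hP.measurable_meanRisk K.lam_pos K.η_mem).aestronglyMeasurable,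
      (eLpNorm_integral_le (hP.measurable_freshRisk K.lam_pos K.η_mem).stronglyMeasurable
        ENNReal.ofNat_ne_top one_le_two).trans_lt
        (hν.memLp_freshRisk hP hn ENNReal.ofNat_ne_top one_le_two).2⟩
  have hrisk : ∀ i : Fin n,
      MemLp (P.riskAt K.lam K.η (Finset.univ.erase i) i) 2 (Measure.pi fun _ : Fin n => ν) :=
    fun i => memLp_of_eLpNorm_le (hP.measurable_riskAt K.lam_pos K.η_mem).aestronglyMeasurable
      (hν.eLpNorm_riskAt_le hP hn ENNReal.ofNat_ne_top one_le_two (Finset.notMem_erase _ _))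
  exact ((memLp_finsetSum _ fun i _ => hrisk i).const_mul _).sub hmean

theorem Constants.IsLaw.integral_sq_looError_le (hν : K.IsLaw ν) (hP : P.Regular K.s K.C K.B)
    (hn0 : n ≠ 0) (hn : n ≤ K.γ * p) :
    ∫ D, P.looError K.lam K.η ν D ^ 2 ∂Measure.pi (fun _ : Fin n => ν) ≤ K.errorBound / n := by
  have := hν.isProbabilityMeasure
  set π := Measure.pi fun _ : Fin n => ν
  set A : (Fin n → Obs p) → ℝ := fun D => (1 / (n : ℝ)) * ∑ i, fluctuation (fun _ => ν) i
    (P.riskAt K.lam K.η (Finset.univ.erase i) i) D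
  set R : (Fin n → Obs p) → ℝ := fun D => (1 / (n : ℝ)) * ∑ i : Fin n,
    (P.meanRisk K.lam K.η ν (Finset.univ.erase i) D - P.meanRisk K.lam K.η ν Finset.univ D)
  have hsplit : P.looError K.lam K.η ν = A + R :=
    funext (P.looError_eq_fluctuation_add K.lam K.η hn0)
  have hRmeas : AEStronglyMeasurable R π := ((Finset.measurable_sum _ fun i _ =>
    (hP.measurable_meanRisk K.lam_pos K.η_mem).sub
      (hP.measurable_meanRisk K.lam_pos K.η_mem)).const_mul _).aestronglyMeasurable
  have hRnorm := hν.eLpNorm_mean_meanRisk_sub_le hP hn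
  have hR : MemLp R 2 π := memLp_of_eLpNorm_le hRmeas hRnorm
  have hA : MemLp A 2 π := by
    simpa only [hsplit, add_sub_cancel_right] using (hν.memLp_looError hP hn).sub hR
  have hscale : ((scale p : ℝ) * K.riskStability 2) ^ 2 ≤ K.γ * K.riskStability 2 ^ 2 / n := by
    rw [le_div_iff₀ (by positivity), mul_pow, mul_right_comm]
    gcongr
    exact_mod_cast sq_scale_mul_le hn
  calc ∫ D, P.looError K.lam K.η ν D ^ 2 ∂π
      ≤ 2 * (∫ D, A D ^ 2 ∂π + ∫ D, R D ^ 2 ∂π) := hsplit ▸ integral_sq_add_le hA hR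
    _ ≤ 2 * ((2 * (K.C * K.estimateWeight 2)) ^ 2 / n + (2 * (scale p * K.riskStability 2)) ^ 2 +
          (scale p * K.riskStability 2) ^ 2) := by
        gcongr
        · exact hν.integral_sq_mean_fluctuation_riskAt_le hP hn
        · simpa only [NNReal.coe_mul] using integral_sq_le hRmeas hRnorm
    _ = 8 * (K.C * K.estimateWeight 2) ^ 2 / n + 10 * (scale p * K.riskStability 2) ^ 2 := by ring
    _ ≤ 8 * (K.C * K.estimateWeight 2) ^ 2 / n + 10 * (K.γ * K.riskStability 2 ^ 2 / n) := by
        gcongr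
    _ = K.errorBound / n := by
        unfold Constants.errorBound
        ring

end LooError

section Sample

variable {K : Constants} {n p : ℕ} {P : Problem p} {Ω : Type*} [MeasurableSpace Ω] {μ : Measure Ω}
  {Z : Fin (n + 1) → Ω → Obs p}

/-- The assumptions of the error bound: a regular problem, and an i.i.d. sample whose size is
positive and at most proportional to the dimension and whose features and responses have bounded
moments. -/
structure Constants.IsSetting (K : Constants) (P : Problem p) (μ : Measure Ω)
    (Z : Fin (n + 1) → Ω → Obs p) : Prop where
  regular : P.Regular K.s K.C K.B
  size_ne_zero : n ≠ 0
  size_le : n ≤ K.γ * p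
  measurable : ∀ i, Measurable (Z i)
  indep : iIndepFun Z μ
  identDistrib : ∀ i, IdentDistrib (Z i) (Z 0) μ μ
  law : K.IsLaw (μ.map (Z 0))

theorem Constants.IsSetting.measurePreserving_prod (h : K.IsSetting P μ Z) :
    MeasurePreserving (fun ω => (train Z ω, Z 0 ω)) μ
      ((Measure.pi fun _ => μ.map (Z 0)).prod (μ.map (Z 0))) := by
  have := h.law.isProbabilityMeasure
  have := h.indep.isProbabilityMeasure
  have hsample : MeasurePreserving (fun ω i => Z i ω) μ (Measure.pi fun _ => μ.map (Z 0)) := by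
    refine ⟨measurable_pi_lambda _ h.measurable, ?_⟩
    simpa only [(h.identDistrib _).map_eq] using
      h.indep.map_fun_eq_pi_map fun i => (h.measurable i).aemeasurable
  exact Measure.measurePreserving_swap.comp
    ((measurePreserving_piFinSuccAbove (fun _ : Fin (n + 1) => μ.map (Z 0)) 0).comp hsample)

theorem Constants.IsSetting.measurePreserving_train (h : K.IsSetting P μ Z) :
    MeasurePreserving (train Z) μ (Measure.pi fun _ => μ.map (Z 0)) :=
  have := h.law.isProbabilityMeasure
  measurePreserving_fst.comp h.measurePreserving_prod

theorem Constants.IsSetting.OO_ae_eq (h : K.IsSetting P μ Z) :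
    P.OO K.lam K.η μ Z =ᵐ[μ]
      fun ω => P.meanRisk K.lam K.η (μ.map (Z 0)) Finset.univ (train Z ω) := by
  have := h.law.isProbabilityMeasure
  have := h.indep.isProbabilityMeasure
  have htrain := h.measurePreserving_train
  have hint : Integrable (Function.uncurry (P.freshRisk K.lam K.η Finset.univ))
      (μ.map fun ω => (train Z ω, Z 0 ω)) := by
    rw [h.measurePreserving_prod.map_eq]
    exact (h.law.memLp_freshRisk h.regular h.size_le ENNReal.one_ne_top le_rfl).integrable le_rfl
  have hcond : condDistrib (Z 0) (train Z) μ =ᵐ[μ.map (train Z)]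
      Kernel.const _ (μ.map (Z 0)) := by
    refine condDistrib_ae_eq_of_measure_eq_compProd _ (h.measurable 0).aemeasurable ?_
    rw [Measure.compProd_const, h.measurePreserving_prod.map_eq, htrain.map_eq]
  refine (condExp_prod_ae_eq_integral_condDistrib' htrain.measurable
    (h.measurable 0).aemeasurable hint).trans ?_
  filter_upwards [ae_of_ae_map htrain.aemeasurable hcond] with ω hω
  rw [hω]
  rfl

theorem Constants.IsSetting.LO_sub_OO_ae_eq (h : K.IsSetting P μ Z) :
    (fun ω => P.LO K.lam K.η Z ω - P.OO K.lam K.η μ Z ω) =ᵐ[μ]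
      P.looError K.lam K.η (μ.map (Z 0)) ∘ train Z := by
  filter_upwards [h.OO_ae_eq] with ω hω
  rw [hω]
  rfl

theorem Constants.IsSetting.memLp_LO_sub_OO (h : K.IsSetting P μ Z) :
    MemLp (fun ω => P.LO K.lam K.η Z ω - P.OO K.lam K.η μ Z ω) 2 μ :=
  (memLp_congr_ae h.LO_sub_OO_ae_eq).2
    ((h.law.memLp_looError h.regular h.size_le).comp_measurePreserving h.measurePreserving_train)

theorem Constants.IsSetting.integral_sq_LO_sub_OO_le (h : K.IsSetting P μ Z) :
    ∫ ω, (P.LO K.lam K.η Z ω - P.OO K.lam K.η μ Z ω) ^ 2 ∂μ ≤ K.errorBound / n := by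
  have := h.law.isProbabilityMeasure
  refine le_of_eq_of_le ?_ (h.law.integral_sq_looError_le h.regular h.size_ne_zero h.size_le)
  rw [← h.measurePreserving_train.map_eq, integral_map h.measurePreserving_train.aemeasurable
    ((h.regular.measurable_looError K.lam_pos K.η_mem).pow_const 2).aestronglyMeasurable]
  exact integral_congr_ae (h.LO_sub_OO_ae_eq.fun_comp (· ^ 2))

theorem tendsto_measure_le_abs_of_integral_sq_le {Ω : ℕ → Type*} [∀ k, MeasurableSpace (Ω k)]
    {μ : ∀ k, Measure (Ω k)} {X : ∀ k, Ω k → ℝ} {b : ℕ → ℝ} (hX : ∀ k, MemLp (X k) 2 (μ k))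
    (hle : ∀ k, ∫ ω, X k ω ^ 2 ∂μ k ≤ b k) (hb : Tendsto b atTop (𝓝 0)) {ε : ℝ} (hε : 0 < ε) :
    Tendsto (fun k => μ k {ω | ε ≤ |X k ω|}) atTop (𝓝 0) := by
  have hchebyshev : ∀ k, μ k {ω | ε ≤ |X k ω|} ≤ ENNReal.ofReal (b k / ε ^ 2) := fun k => by
    have hset : {ω | ε ≤ |X k ω|} = {ω | ENNReal.ofReal (ε ^ 2) ≤ ENNReal.ofReal (X k ω ^ 2)} := by
      ext ω
      rw [Set.mem_ofPred_eq, Set.mem_ofPred_eq, ENNReal.ofReal_le_ofReal_iff (sq_nonneg _),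
        sq_le_sq, abs_of_pos hε]
    have hlintegral : ∫⁻ ω, ENNReal.ofReal (X k ω ^ 2) ∂μ k ≤ ENNReal.ofReal (b k) := by
      rw [← ofReal_integral_eq_lintegral_ofReal (hX k).integrable_sq
        (.of_forall fun ω => sq_nonneg _)]
      exact ENNReal.ofReal_le_ofReal (hle k)
    rw [hset, ENNReal.ofReal_div_of_pos (by positivity)]
    refine (meas_ge_le_lintegral_div ((hX k).integrable_sq.1.aemeasurable.ennreal_ofReal)
      (by simpa using hε.ne') ENNReal.ofReal_ne_top).trans ?_
    gcongr
  refine tendsto_of_tendsto_of_tendsto_of_le_of_le tendsto_const_nhds ?_ (fun _ => zero_le)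
    hchebyshev
  simpa using ENNReal.tendsto_ofReal (hb.div_const (ε ^ 2))

end Sample

section Gaussian

theorem inner_toEuclideanCLM_le_of_eigenvalues_le {ι : Type*} [Fintype ι] [DecidableEq ι]
    {S : Matrix ι ι ℝ} (hS : S.IsHermitian) {c : ℝ} (hc : ∀ i, hS.eigenvalues i ≤ c)
    (v : EuclideanSpace ℝ ι) : inner ℝ v (Matrix.toEuclideanCLM (𝕜 := ℝ) S v) ≤ c * ‖v‖ ^ 2 := by
  set b := hS.eigenvectorBasis
  have heigen : ∀ i, inner ℝ (b i) (Matrix.toEuclideanCLM (𝕜 := ℝ) S v) =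
      hS.eigenvalues i * inner ℝ (b i) v := fun i => by
    rw [Matrix.inner_toEuclideanCLM, Matrix.dotProduct_mulVec, ← Matrix.mulVec_transpose,
      show S.transpose = S from hS, hS.mulVec_eigenvectorBasis, smul_dotProduct, smul_eq_mul,
      EuclideanSpace.inner_eq_star_dotProduct, dotProduct_comm]
    simp [b]
  calc inner ℝ v (Matrix.toEuclideanCLM (𝕜 := ℝ) S v)
      = ∑ i, hS.eigenvalues i * inner ℝ (b i) v ^ 2 := by
        rw [← b.sum_inner_mul_inner]
        refine Finset.sum_congr rfl fun i _ => ?_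
        rw [heigen, real_inner_comm]
        ring
    _ ≤ ∑ i, c * inner ℝ (b i) v ^ 2 := by
        gcongr
        exact hc _
    _ = c * ‖v‖ ^ 2 := by rw [← Finset.mul_sum, b.sum_sq_inner_right]

theorem map_inner_multivariateGaussian {p : ℕ} {S : Matrix (Fin p) (Fin p) ℝ} (hS : S.PosSemidef)
    (v : EuclideanSpace ℝ (Fin p)) :
    (multivariateGaussian 0 S).map (fun x => inner ℝ v x) =
      gaussianReal 0 (inner ℝ v (Matrix.toEuclideanCLM (𝕜 := ℝ) S v)).toNNReal := by
  have hmean : ∫ x, innerSL ℝ v x ∂(multivariateGaussian 0 S) = 0 := by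
    rw [(innerSL ℝ v).integral_comp_id_comm IsGaussian.integrable_id]
    simp
  have hvar : Var[innerSL ℝ v; multivariateGaussian 0 S] =
      inner ℝ v (Matrix.toEuclideanCLM (𝕜 := ℝ) S v) := by
    rw [Matrix.inner_toEuclideanCLM, ← covarianceBilin_multivariateGaussian (μ := 0) hS,
      covarianceBilin_self IsGaussian.memLp_two_id]
    rfl
  rw [← hmean, ← hvar]
  exact IsGaussian.map_eq_gaussianReal (innerSL ℝ v)

theorem eLpNorm_gaussianReal (v : ℝ≥0) (q : ℝ≥0∞) :
    eLpNorm id q (gaussianReal 0 v) = NNReal.sqrt v * eLpNorm id q (gaussianReal 0 1) := by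
  have hmap : gaussianReal 0 v =
      (gaussianReal 0 1).map fun x : ℝ => (NNReal.sqrt v : ℝ) * x := by
    rw [gaussianReal_map_const_mul, mul_zero, mul_one]
    congr 1
    exact NNReal.eq (by simp)
  rw [hmap, eLpNorm_map_measure (by fun_prop) (by fun_prop)]
  refine (eLpNorm_const_smul (NNReal.sqrt v : ℝ) id q _).trans ?_
  rw [NNReal.enorm_eq]

theorem eLpNorm_inner_multivariateGaussian_le {p : ℕ} {S : Matrix (Fin p) (Fin p) ℝ}
    (hS : S.PosSemidef) {c : ℝ≥0} (hc : ∀ i, hS.isHermitian.eigenvalues i ≤ c)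
    (v : EuclideanSpace ℝ (Fin p)) (q : ℝ≥0∞) :
    eLpNorm (fun x => inner ℝ v x) q (multivariateGaussian 0 S) ≤
      NNReal.sqrt c * ‖v‖ₑ * eLpNorm id q (gaussianReal 0 1) := by
  have hvar : NNReal.sqrt (inner ℝ v (Matrix.toEuclideanCLM (𝕜 := ℝ) S v)).toNNReal ≤
      NNReal.sqrt c * ‖v‖₊ := by
    rw [← NNReal.sqrt_sq ‖v‖₊, ← NNReal.sqrt_mul, NNReal.sqrt_le_sqrt, Real.toNNReal_le_iff_le_coe]
    exact inner_toEuclideanCLM_le_of_eigenvalues_le hS.isHermitian hc v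
  calc eLpNorm (fun x => inner ℝ v x) q (multivariateGaussian 0 S)
      = eLpNorm id q ((multivariateGaussian 0 S).map fun x => inner ℝ v x) :=
        (eLpNorm_map_measure (g := id) (by fun_prop) (by fun_prop)).symm
    _ = NNReal.sqrt (inner ℝ v (Matrix.toEuclideanCLM (𝕜 := ℝ) S v)).toNNReal *
          eLpNorm id q (gaussianReal 0 1) := by
        rw [map_inner_multivariateGaussian hS, eLpNorm_gaussianReal]
    _ ≤ NNReal.sqrt c * ‖v‖ₑ * eLpNorm id q (gaussianReal 0 1) := by
        rw [enorm_eq_nnnorm]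
        gcongr
        exact_mod_cast hvar

theorem eLpNorm_le_of_integral_abs_rpow_le {α : Type*} [MeasurableSpace α] {μ : Measure α}
    {f : α → ℝ} {q : ℝ≥0∞} (hq0 : q ≠ 0) (hq : q ≠ ∞)
    (hint : Integrable (fun x => |f x| ^ q.toReal) μ) {c : ℝ}
    (hc : ∫ x, |f x| ^ q.toReal ∂μ ≤ c) :
    eLpNorm f q μ ≤ (c.toNNReal ^ (1 / q.toReal) : ℝ≥0) := by
  have hlintegral : ∫⁻ x, ‖f x‖ₑ ^ q.toReal ∂μ = ENNReal.ofReal (∫ x, |f x| ^ q.toReal ∂μ) := by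
    rw [ofReal_integral_eq_lintegral_ofReal hint (.of_forall fun x => by positivity)]
    refine lintegral_congr fun x => ?_
    rw [Real.enorm_eq_ofReal_abs, ENNReal.ofReal_rpow_of_nonneg (abs_nonneg _) (by positivity)]
  rw [eLpNorm_eq_lintegral_rpow_enorm_toReal hq0 hq, hlintegral,
    ENNReal.coe_rpow_of_nonneg _ (by positivity)]
  gcongr
  exact ENNReal.ofReal_le_ofReal hc

/-- The constants for Gaussian features whose covariance has eigenvalues at most `C_X / p` and for
responses whose absolute moment of order `m` is at most `C_Y m`. -/
noncomputable def Constants.ofGaussian {lam η s C B : ℝ} (γ₀ C_X : ℝ) (C_Y : ℝ → ℝ)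
    (hlam : 0 < lam) (hη : η ∈ Set.Ioo 0 1) (hs : 0 ≤ s) (hC : 0 ≤ C) (hB : 0 ≤ B) :
    Constants where
  γ := γ₀.toNNReal
  s := ⟨s, hs⟩
  C := ⟨C, hC⟩
  B := ⟨B, hB⟩
  lam := ⟨lam, hlam.le⟩
  η := ⟨η, hη.1.le⟩
  lam_pos := hlam
  η_mem := Set.Ioo_subset_Ioc_self hη
  G q := NNReal.sqrt C_X.toNNReal * (eLpNorm id q (gaussianReal 0 1)).toNNReal
  H q := (C_Y q.toReal).toNNReal ^ (1 / q.toReal)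

variable {γ₀ lam η s C C_X B : ℝ} {C_Y : ℝ → ℝ} {n p : ℕ} {P : Problem p} {Ω : Type*}
  [MeasurableSpace Ω] {μ : Measure Ω} {Z : Fin (n + 1) → Ω → Obs p}

theorem Problem.IsSample.eLpNorm_features_le (hZ : P.IsSample C_Y μ Z)
    (hP : P.Admissible s C C_X B) (v : EuclideanSpace ℝ (Fin p)) (q : ℝ≥0∞) :
    eLpNorm (fun z : Obs p => inner ℝ z.1 v) q (μ.map (Z 0)) ≤
      scale p * NNReal.sqrt C_X.toNNReal * ‖v‖ₑ * eLpNorm id q (gaussianReal 0 1) := by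
  obtain ⟨c_X, -, -, heigen⟩ := hP.cov_eigenvalues
  have hle : ∀ i, hP.cov_posSemidef.isHermitian.eigenvalues i ≤ (C_X.toNNReal / p : ℝ≥0) :=
    fun i => (heigen i).2.trans (by
      push_cast
      gcongr
      exact Real.le_coe_toNNReal C_X)
  have hscale : NNReal.sqrt (C_X.toNNReal / p) = scale p * NNReal.sqrt C_X.toNNReal := by
    rw [NNReal.sqrt_div, scale, div_eq_inv_mul]
  calc eLpNorm (fun z : Obs p => inner ℝ z.1 v) q (μ.map (Z 0))
      = eLpNorm (fun x => inner ℝ v x) q (multivariateGaussian 0 P.cov) := by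
        rw [eLpNorm_map_measure (by fun_prop) (hZ.measurable 0).aemeasurable,
          ← (hZ.features 0).map_eq,
          eLpNorm_map_measure (by fun_prop) (hZ.measurable 0).fst.aemeasurable]
        simp only [Function.comp_def, real_inner_comm]
    _ ≤ scale p * NNReal.sqrt C_X.toNNReal * ‖v‖ₑ * eLpNorm id q (gaussianReal 0 1) := by
        rw [← ENNReal.coe_mul, ← hscale]
        exact eLpNorm_inner_multivariateGaussian_le hP.cov_posSemidef hle v q

theorem Problem.IsSample.isLaw_ofGaussian (hZ : P.IsSample C_Y μ Z)
    (hP : P.Admissible s C C_X B) (hlam : 0 < lam) (hη : η ∈ Set.Ioo 0 1) (hs : 0 ≤ s)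
    (hC : 0 ≤ C) (hB : 0 ≤ B) :
    (Constants.ofGaussian γ₀ C_X C_Y hlam hη hs hC hB).IsLaw (μ.map (Z 0)) where
  isProbabilityMeasure :=
    have := hZ.indep.isProbabilityMeasure
    Measure.isProbabilityMeasure_map (hZ.measurable 0).aemeasurable
  features q hq v := by
    have hfinite : eLpNorm id q (gaussianReal 0 1) ≠ ∞ := by
      lift q to ℝ≥0 using hq
      exact (memLp_id_gaussianReal q).eLpNorm_ne_top
    refine (hZ.eLpNorm_features_le hP v q).trans_eq ?_
    simp only [Constants.ofGaussian, ENNReal.coe_mul, ENNReal.coe_toNNReal hfinite]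
    ring
  responses q hq := by
    rcases eq_or_ne q 0 with rfl | hq0
    · simp
    obtain ⟨hint, hle⟩ := hZ.moments 0 q.toReal (ENNReal.toReal_pos hq0 hq)
    rw [eLpNorm_map_measure (by fun_prop) (hZ.measurable 0).aemeasurable]
    exact eLpNorm_le_of_integral_abs_rpow_le hq0 hq hint hle

theorem Problem.IsSample.isSetting_ofGaussian (hZ : P.IsSample C_Y μ Z)
    (hP : P.Admissible s C C_X B) (hγ₀ : 0 < γ₀) (hratio : (n : ℝ) / p = γ₀) (hlam : 0 < lam)
    (hη : η ∈ Set.Ioo 0 1) (hs : 0 ≤ s) (hC : 0 ≤ C) (hB : 0 ≤ B) :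
    (Constants.ofGaussian γ₀ C_X C_Y hlam hη hs hC hB).IsSetting P μ Z where
  regular := hP.regular
  size_ne_zero := by
    rintro rfl
    simp [hγ₀.ne] at hratio
  size_le := by
    have hp : (p : ℝ) ≠ 0 := fun hp => by simp [hp, hγ₀.ne] at hratio
    rw [← NNReal.coe_le_coe, NNReal.coe_mul]
    simp [Constants.ofGaussian, ← hratio, div_nonneg, hp]
  measurable := hZ.measurable
  indep := hZ.indep
  identDistrib := hZ.identDistrib
  law := hZ.isLaw_ofGaussian hP hlam hη hs hC hB

end Gaussian

end LeaveOneOut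

theorem theorem1_general (K : LeaveOneOut.Constants) :
    (∃ C_v : ℝ, ∀ (n p : ℕ) (P : LeaveOneOut.Problem p) (Ω : Type*) [MeasurableSpace Ω]
        (μ : Measure Ω) (Z : Fin (n + 1) → Ω → LeaveOneOut.Obs p), K.IsSetting P μ Z →
      Integrable (fun ω => (P.LO K.lam K.η Z ω - P.OO K.lam K.η μ Z ω) ^ 2) μ ∧
        ∫ ω, (P.LO K.lam K.η Z ω - P.OO K.lam K.η μ Z ω) ^ 2 ∂μ ≤ C_v / n) ∧
    (∀ (n p : ℕ → ℕ), Tendsto n atTop atTop → ∀ (P : ∀ k, LeaveOneOut.Problem (p k))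
        (Ω : ℕ → Type*) [∀ k, MeasurableSpace (Ω k)] (μ : ∀ k, Measure (Ω k))
        (Z : ∀ k, Fin (n k + 1) → Ω k → LeaveOneOut.Obs (p k)),
        (∀ k, K.IsSetting (P k) (μ k) (Z k)) →
      ∀ ε : ℝ, 0 < ε →
        Tendsto (fun k => μ k {ω | ε ≤ |(P k).LO K.lam K.η (Z k) ω -
          (P k).OO K.lam K.η (μ k) (Z k) ω|}) atTop (𝓝 0)) := by
  refine ⟨⟨K.errorBound, fun n p P Ω _ μ Z h =>
    ⟨h.memLp_LO_sub_OO.integrable_sq, h.integral_sq_LO_sub_OO_le⟩⟩, ?_⟩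
  intro n p hn P Ω _ μ Z h ε hε
  exact LeaveOneOut.tendsto_measure_le_abs_of_integral_sq_le (fun k => (h k).memLp_LO_sub_OO)
    (fun k => (h k).integral_sq_LO_sub_OO_le)
    (tendsto_const_nhds.div_atTop (tendsto_natCast_atTop_atTop.comp hn)) hε

theorem theorem1 (γ₀ lam η s C C_X B : ℝ) (C_Y : ℝ → ℝ)
    (hγ₀ : 0 < γ₀) (hlam : 0 < lam) (hη : η ∈ Set.Ioo (0 : ℝ) 1) (hs : 0 ≤ s) (hC : 0 < C)
    (hC_X : 0 < C_X) (hB : 0 ≤ B) :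
    -- the bound, with a constant that depends only on the parameters above
    (∃ C_v : ℝ, ∀ (n p : ℕ), (n : ℝ) / p = γ₀ →
      ∀ (P : LeaveOneOut.Problem p), P.Admissible s C C_X B →
      ∀ (Ω : Type*) [MeasurableSpace Ω] (μ : Measure Ω) [IsProbabilityMeasure μ]
        (Z : Fin (n + 1) → Ω → LeaveOneOut.Obs p), P.IsSample C_Y μ Z →
      Integrable (fun ω => (P.LO lam η Z ω - P.OO lam η μ Z ω) ^ 2) μ ∧
        ∫ ω, (P.LO lam η Z ω - P.OO lam η μ Z ω) ^ 2 ∂μ ≤ C_v / n) ∧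
    -- consistency along every sequence of problems with growing sample size
    (∀ (n p : ℕ → ℕ), (∀ k, (n k : ℝ) / p k = γ₀) → Tendsto n atTop atTop →
      ∀ (P : ∀ k, LeaveOneOut.Problem (p k)), (∀ k, (P k).Admissible s C C_X B) →
      ∀ (Ω : ℕ → Type*) [∀ k, MeasurableSpace (Ω k)] (μ : ∀ k, Measure (Ω k))
        [∀ k, IsProbabilityMeasure (μ k)]
        (Z : ∀ k, Fin (n k + 1) → Ω k → LeaveOneOut.Obs (p k)),
        (∀ k, (P k).IsSample C_Y (μ k) (Z k)) →
      ∀ ε : ℝ, 0 < ε →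
        Tendsto (fun k => μ k {ω | ε ≤ |(P k).LO lam η (Z k) ω - (P k).OO lam η (μ k) (Z k) ω|})
          atTop (𝓝 0)) := by
  obtain ⟨⟨C_v, hbound⟩, hconsistent⟩ := theorem1_general
    (LeaveOneOut.Constants.ofGaussian γ₀ C_X C_Y hlam hη hs hC.le hB)
  exact ⟨⟨C_v, fun n p hratio P hP Ω _ μ _ Z hZ => hbound n p P Ω μ Z
      (hZ.isSetting_ofGaussian hP hγ₀ hratio hlam hη hs hC.le hB)⟩,
    fun n p hratio hn P hP Ω _ μ _ Z hZ => hconsistent n p hn P Ω μ Z fun k =>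
      (hZ k).isSetting_ofGaussian (hP k) hγ₀ (hratio k) hlam hη hs hC.le hB⟩
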